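/- Let $I\subset\mathbb R$ be a bounded (nondegenerate) interval, let $\langle\cdot,\cdot\rangle$ and $|\cdot|$ be the Euclidean inner product and norm on $\mathbb R^N$, and let $G\colon\mathbb R^N\to[0,\infty)$ satisfy * $(G_1)$ $G(0)=0$; $(G_2)$ $G$ is convex; $(G_3)$ $G(-x)=G(x)$ for all $x$; $(G_4)$ $\lim_{|x|\to\infty}G(x)/|x|=\infty$; * $(G_5)$ there are $K_1\ge 2$ and $M_1>0$ with $G(2x)\le K_1G(x)$ whenever $|x|\ge M_1$; * $(G_6)$ there are $K_2\ge 1$ and $M_2>0$ with $G(x)\le\frac1{2K_2}G(K_2x)$ whenever $|x|\ge M_2$; * $(G_7)$ $G$ is of class $C^1$. Let $G^*(y)=\sup_{x\in\mathbb R^N}\{\langle x,y\rangle-G(x)\}$ be the Fenchel conjugate of $G$. Let $L^G(I,\mathbb R^N)$ be the space of (classes modulo a.e. equality of) measurable $u\colon I\to\mathbb R^N$ with $\int_I G(u)\,dt<\infty$, with the Luxemburg norm $\|u\|_{L^G}=\inf\{\alpha>0:\int_I G(u/\alpha)\,dt\le 1\}$, and let $W^1L^G(I,\mathbb R^N)=\{u\in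 L^G(I,\mathbb R^N):\dot u\in L^G(I,\mathbb R^N)\}$, where $\dot u$ is the weak derivative, with the norm $\|u\|_{W^1L^G}=\|u\|_{L^G}+\|\dot u\|_{L^G}$. Let $F\colon I\times\mathbb R^N\times\mathbb R^N\to\mathbb R$, $(t,x,v)\mapsto F(t,x,v)$, and suppose that there are a continuous function $a\colon[0,\infty)\to[0,\infty)$ and nonnegative functions $b,c\in L^1(I)$ such that * $(F_1)$ $F$ is of class $C^1$, and, for almost every $t\in I$ and all $x,v\in\mathbb R^N$, * $(F_2)$ $|F(t,x,v)|\le a(|x|)\,(b(t)+G(v))$, * $(F_3)$ $|F_x(t,x,v)|\le a(|x|)\,(b(t)+G(v))$, * $(F_4)$ $G^*(F_v(t,x,v))\le a(|x|)\,(c(t)+G^*(\nabla G(v)))$, where $F_x$ and $F_v$ are the gradients of $F$ in $x$ and in $v$. Then $\mathcal I(u)=\int_I F(t,u(t),\dot u(t))\,dt$ is well defined and finite for every $u\in W^1L^G(I,\mathbb R^N)$, the functional $\mathcal I\colon W^1L^G(I,\mathbb R^N)\to\mathbb R$ is of class $C^1$, and for all $u,\varphi\in W^1L^G(I,\mathbb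 R^N)$ $$\mathcal I'(u)\varphi=\int_I\langle F_x(t,u,\dot u),\varphi\rangle\,dt+\int_I\langle F_v(t,u,\dot u),\dot\varphi\rangle\,dt,$$ where both integrands are integrable. -/

import Mathlib

open MeasureTheory Filter Set Topology
open scoped NNReal ContDiff

noncomputable section

/-- The Euclidean space `ℝ^N`. -/
abbrev Vec (N : ℕ) : Type := EuclideanSpace ℝ (Fin N)

/-- Functions `G : ℝ^N → [0, ∞)` with `G 0 = 0` that are convex, even, supercoercive and satisfy
the `Δ₂` and `∇₂` conditions. -/
structure GFunction (N : ℕ) where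
  toFun : Vec N → ℝ
  nonneg : ∀ x, 0 ≤ toFun x
  map_zero : toFun 0 = 0
  convex : ConvexOn ℝ univ toFun
  even : ∀ x, toFun (-x) = toFun x
  supercoercive : Tendsto (fun x => toFun x / ‖x‖) (Bornology.cobounded (Vec N)) atTop
  delta2 : ∃ K₁ : ℝ, 2 ≤ K₁ ∧ ∃ M₁ : ℝ, 0 < M₁ ∧
    ∀ x, M₁ ≤ ‖x‖ → toFun ((2 : ℝ) • x) ≤ K₁ * toFun x
  nabla2 : ∃ K₂ : ℝ, 1 ≤ K₂ ∧ ∃ M₂ : ℝ, 0 < M₂ ∧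
    ∀ x, M₂ ≤ ‖x‖ → toFun x ≤ 1 / (2 * K₂) * toFun (K₂ • x)

instance (N : ℕ) : CoeFun (GFunction N) (fun _ => Vec N → ℝ) := ⟨GFunction.toFun⟩

/-- A bounded nondegenerate interval of the real line: open, closed or half-open. -/
structure FiniteInterval where
  left : ℝ
  right : ℝ
  left_lt_right : left < right
  carrier : Set ℝ
  Ioo_subset : Ioo left right ⊆ carrier
  subset_Icc : carrier ⊆ Icc left right

/-- Lebesgue measure on the interval `I`. -/
abbrev FiniteInterval.measure (I : FiniteInterval) : Measure ℝ := volume.restrict I.carrier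

instance (I : FiniteInterval) : IsFiniteMeasure I.measure :=
  ⟨by
    rw [Measure.restrict_apply_univ]
    exact (measure_mono I.subset_Icc).trans_lt measure_Icc_lt_top⟩

namespace GFunction

variable {N : ℕ} (G : GFunction N)

/-- The Fenchel conjugate `G*(y) = sup_x (⟨x, y⟩ - G x)`; the supremum is finite by
`GFunction.bddAbove_conj`. -/
def conj (y : Vec N) : ℝ := ⨆ x : Vec N, (inner ℝ x y - G x)

/-- The modular `∫_I G(u) dt`, with values in `[0, ∞]`. -/
def modular (I : FiniteInterval) (u : ℝ → Vec N) : ENNReal :=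
  ∫⁻ t, ENNReal.ofReal (G (u t)) ∂I.measure

theorem continuous : Continuous G := G.convex.locallyLipschitz.continuous

theorem exists_linear_le (c : ℝ) : ∃ R : ℝ, 0 ≤ R ∧ ∀ x, c * ‖x‖ - R ≤ G x := by
  have h := G.supercoercive.eventually_ge_atTop c
  obtain ⟨r, hr⟩ := (Metric.hasBasis_cobounded_compl_closedBall (0 : Vec N)).eventually_iff.1 h
  refine ⟨|c| * |r|, by positivity, fun x => ?_⟩
  by_cases hx : ‖x‖ ≤ |r|
  · have h1 : c * ‖x‖ ≤ |c| * |r| :=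
      (mul_le_mul_of_nonneg_right (le_abs_self c) (norm_nonneg x)).trans
        (mul_le_mul_of_nonneg_left hx (abs_nonneg c))
    linarith [G.nonneg x]
  · have hx' : |r| < ‖x‖ := not_le.1 hx
    have hpos : 0 < ‖x‖ := (abs_nonneg r).trans_lt hx'
    have h2 : c ≤ G x / ‖x‖ := hr.2 (by
      simp only [mem_compl_iff, Metric.mem_closedBall, dist_zero_right, not_le]
      exact (le_abs_self r).trans_lt hx')
    rw [le_div_iff₀ hpos] at h2
    have : 0 ≤ |c| * |r| := by positivity
    linarith

theorem bddAbove_conj (y : Vec N) : BddAbove (range fun x : Vec N => inner ℝ x y - G x) := by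
  obtain ⟨R, -, hR⟩ := G.exists_linear_le ‖y‖
  refine ⟨R, ?_⟩
  rintro _ ⟨x, rfl⟩
  have h1 := real_inner_le_norm x y
  have h2 := hR x
  change inner ℝ x y - G x ≤ R
  nlinarith

theorem smul_le {c : ℝ} (h0 : 0 ≤ c) (h1 : c ≤ 1) (x : Vec N) : G (c • x) ≤ c * G x := by
  have h := G.convex.2 (mem_univ x) (mem_univ (0 : Vec N)) h0 (sub_nonneg.2 h1) (by ring)
  simpa [G.map_zero] using h

theorem exists_two_smul_le : ∃ C K : ℝ, 0 ≤ C ∧ 0 ≤ K ∧ ∀ x, G ((2 : ℝ) • x) ≤ C + K * G x := by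
  obtain ⟨K, hK, M, hM, h⟩ := G.delta2
  have hc : Continuous fun x : Vec N => G ((2 : ℝ) • x) :=
    G.continuous.comp (continuous_const_smul (2 : ℝ))
  obtain ⟨C, hC⟩ := (isCompact_closedBall (0 : Vec N) M).bddAbove_image hc.continuousOn
  refine ⟨|C|, K, abs_nonneg C, by linarith, fun x => ?_⟩
  by_cases hx : M ≤ ‖x‖
  · linarith [h x hx, abs_nonneg C]
  · have h1 : G ((2 : ℝ) • x) ≤ C :=
      hC ⟨x, by simpa using (not_le.1 hx).le, rfl⟩
    have h2 : 0 ≤ K * G x := mul_nonneg (by linarith) (G.nonneg x)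
    linarith [le_abs_self C]

theorem exists_pow_smul_le (n : ℕ) :
    ∃ C K : ℝ, 0 ≤ C ∧ 0 ≤ K ∧ ∀ x, G ((2 : ℝ) ^ n • x) ≤ C + K * G x := by
  induction n with
  | zero => exact ⟨0, 1, le_rfl, zero_le_one, fun x => by simp⟩
  | succ n ih =>
    obtain ⟨C, K, hC, hK, h⟩ := ih
    obtain ⟨C', K', hC', hK', h'⟩ := G.exists_two_smul_le
    refine ⟨C' + K' * C, K' * K, by positivity, by positivity, fun x => ?_⟩
    have h1 := h' ((2 : ℝ) ^ n • x)
    rw [smul_smul, ← pow_succ'] at h1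
    nlinarith [mul_le_mul_of_nonneg_left (h x) hK']

theorem exists_smul_le (c : ℝ) :
    ∃ C K : ℝ, 0 ≤ C ∧ 0 ≤ K ∧ ∀ x, G (c • x) ≤ C + K * G x := by
  obtain ⟨n, hn⟩ := pow_unbounded_of_one_lt |c| (one_lt_two : (1 : ℝ) < 2)
  obtain ⟨C, K, hC, hK, h⟩ := G.exists_pow_smul_le n
  refine ⟨C, K, hC, hK, fun x => le_trans ?_ (h x)⟩
  have h2 : (0 : ℝ) < 2 ^ n := by positivity
  have key : G (|c| • x) ≤ G ((2 : ℝ) ^ n • x) := by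
    have h3 := G.smul_le (c := |c| / 2 ^ n) (by positivity) ((div_le_one h2).2 hn.le)
      ((2 : ℝ) ^ n • x)
    rw [smul_smul, div_mul_cancel₀ _ h2.ne'] at h3
    refine h3.trans (mul_le_of_le_one_left (G.nonneg _) ((div_le_one h2).2 hn.le))
  rcases abs_cases c with ⟨hc, -⟩ | ⟨hc, -⟩
  · rwa [hc] at key
  · rw [hc, neg_smul, G.even] at key
    exact key

variable (I : FiniteInterval)

theorem modular_congr {u v : ℝ → Vec N} (h : u =ᵐ[I.measure] v) :
    G.modular I u = G.modular I v :=
  lintegral_congr_ae (h.mono fun t ht => by simp only [ht])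

theorem aemeasurable_comp {u : ℝ → Vec N} (hu : AEStronglyMeasurable u I.measure) :
    AEMeasurable (fun t => ENNReal.ofReal (G (u t))) I.measure :=
  (G.continuous.comp_aestronglyMeasurable hu).aemeasurable.ennreal_ofReal

theorem modular_smul_lt_top (c : ℝ) {u : ℝ → Vec N} (h : G.modular I u < ⊤) :
    G.modular I (fun t => c • u t) < ⊤ := by
  obtain ⟨C, K, hC, hK, hle⟩ := G.exists_smul_le c
  have h1 : G.modular I (fun t => c • u t) ≤
      ∫⁻ t, (ENNReal.ofReal C + ENNReal.ofReal K * ENNReal.ofReal (G (u t))) ∂I.measure := by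
    refine lintegral_mono fun t => ?_
    rw [← ENNReal.ofReal_mul hK, ← ENNReal.ofReal_add hC (mul_nonneg hK (G.nonneg _))]
    exact ENNReal.ofReal_le_ofReal (hle _)
  refine h1.trans_lt ?_
  rw [lintegral_add_left measurable_const, lintegral_const_mul' _ _ ENNReal.ofReal_ne_top,
    lintegral_const]
  exact ENNReal.add_lt_top.2 ⟨ENNReal.mul_lt_top ENNReal.ofReal_lt_top (measure_lt_top _ _),
    ENNReal.mul_lt_top ENNReal.ofReal_lt_top h⟩

/-- Convexity of the modular. -/
theorem modular_comb_le {u v : ℝ → Vec N} (hu : AEStronglyMeasurable u I.measure)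
    {p q : ℝ} (hp : 0 ≤ p) (hq : 0 ≤ q) (hpq : p + q = 1) :
    G.modular I (fun t => p • u t + q • v t) ≤
      ENNReal.ofReal p * G.modular I u + ENNReal.ofReal q * G.modular I v := by
  unfold modular
  rw [← lintegral_const_mul' _ _ ENNReal.ofReal_ne_top,
    ← lintegral_const_mul' _ _ ENNReal.ofReal_ne_top,
    ← lintegral_add_left' ((G.aemeasurable_comp I hu).const_mul _)]
  refine lintegral_mono fun t => ?_
  rw [← ENNReal.ofReal_mul hp, ← ENNReal.ofReal_mul hq,
    ← ENNReal.ofReal_add (mul_nonneg hp (G.nonneg _)) (mul_nonneg hq (G.nonneg _))]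
  exact ENNReal.ofReal_le_ofReal (G.convex.2 (mem_univ _) (mem_univ _) hp hq hpq)

theorem modular_add_lt_top {u v : ℝ → Vec N} (hu : AEStronglyMeasurable u I.measure)
    (h : G.modular I u < ⊤) (h' : G.modular I v < ⊤) :
    G.modular I (fun t => u t + v t) < ⊤ := by
  have h1 := G.modular_comb_le I (v := fun t => (2 : ℝ) • v t) (hu.const_smul (2 : ℝ))
    (p := 1 / 2) (q := 1 / 2) (by norm_num) (by norm_num) (by norm_num)
  have h2 : (fun t => (1 / 2 : ℝ) • ((2 : ℝ) • u) t + (1 / 2 : ℝ) • (2 : ℝ) • v t) =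
      fun t => u t + v t := by
    funext t
    simp [smul_smul]
  rw [h2] at h1
  exact h1.trans_lt (ENNReal.add_lt_top.2
    ⟨ENNReal.mul_lt_top ENNReal.ofReal_lt_top (G.modular_smul_lt_top I 2 h),
      ENNReal.mul_lt_top ENNReal.ofReal_lt_top (G.modular_smul_lt_top I 2 h')⟩)

end GFunction

variable {N : ℕ}

/-- The anisotropic Orlicz space `L^G(I, ℝ^N)`: classes, modulo equality a.e. on `I`, of measurable
functions `u` with `∫_I G(u) dt < ⊤`. -/
def orliczSubmodule (G : GFunction N) (I : FiniteInterval) :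
    Submodule ℝ (ℝ →ₘ[I.measure] Vec N) where
  carrier := {u | G.modular I u < ⊤}
  add_mem' := by
    intro u v hu hv
    change G.modular I (u + v : ℝ →ₘ[I.measure] Vec N) < ⊤
    rw [G.modular_congr I (AEEqFun.coeFn_add u v)]
    exact G.modular_add_lt_top I u.aestronglyMeasurable hu hv
  zero_mem' := by
    change G.modular I (0 : ℝ →ₘ[I.measure] Vec N) < ⊤
    rw [G.modular_congr I AEEqFun.coeFn_zero]
    simp [GFunction.modular, G.map_zero]
  smul_mem' := by
    intro c u hu
    change G.modular I (c • u : ℝ →ₘ[I.measure] Vec N) < ⊤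
    rw [G.modular_congr I (AEEqFun.coeFn_smul c u)]
    exact G.modular_smul_lt_top I c hu

/-- The Orlicz space as a type. -/
def OrliczSpace (G : GFunction N) (I : FiniteInterval) : Type := ↥(orliczSubmodule G I)

instance (G : GFunction N) (I : FiniteInterval) : AddCommGroup (OrliczSpace G I) :=
  inferInstanceAs (AddCommGroup ↥(orliczSubmodule G I))

instance (G : GFunction N) (I : FiniteInterval) : Module ℝ (OrliczSpace G I) :=
  inferInstanceAs (Module ℝ ↥(orliczSubmodule G I))

namespace OrliczSpace

variable {G : GFunction N} {I : FiniteInterval}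

instance : CoeFun (OrliczSpace G I) (fun _ => ℝ → Vec N) := ⟨fun u => (u.1 : ℝ → Vec N)⟩

theorem coe_add (u v : OrliczSpace G I) : (u + v) =ᵐ[I.measure] fun t => u t + v t :=
  AEEqFun.coeFn_add u.1 v.1

theorem coe_smul (c : ℝ) (u : OrliczSpace G I) : (c • u) =ᵐ[I.measure] fun t => c • u t :=
  AEEqFun.coeFn_smul c u.1

theorem aesm (u : OrliczSpace G I) : AEStronglyMeasurable u I.measure := u.1.aestronglyMeasurable

theorem ext_ae {u v : OrliczSpace G I} (h : u =ᵐ[I.measure] v) : u = v :=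
  Subtype.ext (AEEqFun.ext h)

theorem lintegral_enorm_le (G : GFunction N) (I : FiniteInterval) :
    ∃ C : ENNReal, C < ⊤ ∧ ∀ u : ℝ → Vec N, ∫⁻ t, ‖u t‖ₑ ∂I.measure ≤ C + G.modular I u := by
  obtain ⟨R, hR0, hR⟩ := G.exists_linear_le 1
  refine ⟨∫⁻ _, ENNReal.ofReal R ∂I.measure, ?_, fun u => ?_⟩
  · rw [lintegral_const]
    exact ENNReal.mul_lt_top ENNReal.ofReal_lt_top (measure_lt_top _ _)
  · unfold GFunction.modular
    rw [← lintegral_add_left measurable_const]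
    refine lintegral_mono fun t => ?_
    rw [← ENNReal.ofReal_add hR0 (G.nonneg _), ← ofReal_norm]
    exact ENNReal.ofReal_le_ofReal (by linarith [hR (u t)])

theorem integrable (u : OrliczSpace G I) : Integrable u I.measure := by
  obtain ⟨C, hC, h⟩ := lintegral_enorm_le G I
  exact ⟨u.aesm, (h u).trans_lt (ENNReal.add_lt_top.2 ⟨hC, u.2⟩)⟩

/-- The Luxemburg norm `inf {α > 0 | ∫_I G(u / α) dt ≤ 1}`. -/
def luxemburg (u : OrliczSpace G I) : ℝ :=
  sInf {α : ℝ | 0 < α ∧ G.modular I (fun t => α⁻¹ • u t) ≤ 1}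

theorem luxemburg_nonneg (u : OrliczSpace G I) : 0 ≤ luxemburg u :=
  Real.sInf_nonneg fun _ h => h.1.le

theorem luxemburg_le {u : OrliczSpace G I} {α : ℝ} (h : 0 < α)
    (h' : G.modular I (fun t => α⁻¹ • u t) ≤ 1) : luxemburg u ≤ α :=
  csInf_le ⟨0, fun _ h => h.1.le⟩ ⟨h, h'⟩

theorem luxemburg_set_nonempty (u : OrliczSpace G I) :
    {α : ℝ | 0 < α ∧ G.modular I (fun t => α⁻¹ • u t) ≤ 1}.Nonempty := by
  set m : ℝ := (G.modular I u).toReal with hm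
  have hm0 : 0 ≤ m := ENNReal.toReal_nonneg
  have hmm : G.modular I u = ENNReal.ofReal m := (ENNReal.ofReal_toReal (LT.lt.ne (show G.modular I u < ⊤ from u.2))).symm
  have hpos : 0 < 1 + m := by linarith
  refine ⟨1 + m, hpos, ?_⟩
  have h1 : G.modular I (fun t => (1 + m)⁻¹ • u t) ≤
      ENNReal.ofReal (1 + m)⁻¹ * G.modular I u := by
    unfold GFunction.modular
    rw [← lintegral_const_mul' _ _ ENNReal.ofReal_ne_top]
    refine lintegral_mono fun t => ?_
    rw [← ENNReal.ofReal_mul (by positivity)]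
    exact ENNReal.ofReal_le_ofReal
      (G.smul_le (by positivity) (inv_le_one_of_one_le₀ (by linarith)) _)
  refine h1.trans ?_
  rw [hmm, ← ENNReal.ofReal_mul (by positivity), ← ENNReal.ofReal_one]
  refine ENNReal.ofReal_le_ofReal ?_
  rw [inv_mul_le_iff₀ hpos]
  linarith

theorem exists_lt_of_luxemburg_lt {u : OrliczSpace G I} {r : ℝ} (h : luxemburg u < r) :
    ∃ α : ℝ, 0 < α ∧ α < r ∧ G.modular I (fun t => α⁻¹ • u t) ≤ 1 := by
  obtain ⟨α, hα, hlt⟩ := exists_lt_of_csInf_lt (luxemburg_set_nonempty u) h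
  exact ⟨α, hα.1, hlt, hα.2⟩

theorem luxemburg_add_le (u v : OrliczSpace G I) :
    luxemburg (u + v) ≤ luxemburg u + luxemburg v := by
  refine le_of_forall_pos_le_add fun ε hε => ?_
  obtain ⟨α, hα, hαlt, hα1⟩ := exists_lt_of_luxemburg_lt
    (show luxemburg u < luxemburg u + ε / 2 by linarith)
  obtain ⟨β, hβ, hβlt, hβ1⟩ := exists_lt_of_luxemburg_lt
    (show luxemburg v < luxemburg v + ε / 2 by linarith)
  have hab : 0 < α + β := by linarith
  refine (luxemburg_le (α := α + β) hab ?_).trans (by linarith)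
  have h1 := G.modular_comb_le I (v := fun t => β⁻¹ • v t) (u.aesm.const_smul α⁻¹)
    (p := α / (α + β)) (q := β / (α + β)) (by positivity) (by positivity) (by field_simp)
  have h2 : (fun t => (α + β)⁻¹ • (u + v) t) =ᵐ[I.measure]
      fun t => (α / (α + β)) • (α⁻¹ • u.1) t + (β / (α + β)) • β⁻¹ • v t := by
    filter_upwards [coe_add u v, AEEqFun.coeFn_smul α⁻¹ u.1] with t ht ht'
    rw [ht, ht', Pi.smul_apply, smul_add, smul_smul, smul_smul]
    congr 2 <;> field_simp
  have h3 : (fun t => (α / (α + β)) • (α⁻¹ • u.1) t + (β / (α + β)) • β⁻¹ • v t) =ᵐ[I.measure]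
      fun t => (α / (α + β)) • (α⁻¹ • (u : ℝ → Vec N)) t + (β / (α + β)) • β⁻¹ • v t := by
    filter_upwards [AEEqFun.coeFn_smul α⁻¹ u.1] with t ht'
    rw [ht']
  rw [G.modular_congr I (h2.trans h3)]
  refine h1.trans ?_
  calc _ ≤ ENNReal.ofReal (α / (α + β)) * 1 + ENNReal.ofReal (β / (α + β)) * 1 := by
        gcongr
        · exact hα1
    _ = 1 := by
        rw [mul_one, mul_one, ← ENNReal.ofReal_add (by positivity) (by positivity), ← add_div,
          div_self hab.ne', ENNReal.ofReal_one]

theorem luxemburg_zero : luxemburg (0 : OrliczSpace G I) = 0 := by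
  refine le_antisymm (le_of_forall_pos_le_add fun ε hε => ?_) (luxemburg_nonneg _)
  refine (luxemburg_le hε ?_).trans (by linarith)
  have h : (fun t => ε⁻¹ • (0 : OrliczSpace G I) t) =ᵐ[I.measure] fun _ => 0 := by
    filter_upwards [AEEqFun.coeFn_zero (α := ℝ) (β := Vec N) (μ := I.measure)] with t ht
    change ε⁻¹ • (0 : ℝ →ₘ[I.measure] Vec N) t = 0
    rw [ht]
    simp
  rw [G.modular_congr I h]
  simp [GFunction.modular, G.map_zero]

theorem luxemburg_smul_le {c : ℝ} (hc : c ≠ 0) (u : OrliczSpace G I) :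
    luxemburg (c • u) ≤ |c| * luxemburg u := by
  have hc' : 0 < |c| := abs_pos.2 hc
  rw [← div_le_iff₀' hc']
  refine le_csInf (luxemburg_set_nonempty u) fun α hα => ?_
  rw [div_le_iff₀' hc']
  refine luxemburg_le (mul_pos hc' hα.1) ?_
  refine le_trans (le_of_eq ?_) hα.2
  have h : (fun t => (|c| * α)⁻¹ • (c • u) t) =ᵐ[I.measure]
      fun t => (|c| * α)⁻¹ • c • u t := by
    filter_upwards [coe_smul c u] with t ht
    rw [ht]
  rw [G.modular_congr I h]
  refine lintegral_congr fun t => ?_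
  congr 1
  change G ((|c| * α)⁻¹ • c • u t) = G (α⁻¹ • u t)
  rw [smul_smul]
  rcases abs_cases c with ⟨hcc, -⟩ | ⟨hcc, -⟩
  · rw [hcc, mul_inv, mul_comm c⁻¹, mul_assoc, inv_mul_cancel₀ hc, mul_one]
  · rw [hcc, ← G.even, ← neg_smul]
    congr 2
    have := hα.1.ne'
    field_simp

theorem luxemburg_smul (c : ℝ) (u : OrliczSpace G I) :
    luxemburg (c • u) = |c| * luxemburg u := by
  by_cases hc : c = 0
  · simp [hc, luxemburg_zero]
  refine le_antisymm (luxemburg_smul_le hc u) ?_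
  have h := luxemburg_smul_le (inv_ne_zero hc) (c • u)
  rw [smul_smul, inv_mul_cancel₀ hc, one_smul, abs_inv] at h
  rwa [← le_inv_mul_iff₀ (abs_pos.2 hc)]

theorem eq_zero_of_luxemburg {u : OrliczSpace G I} (h : luxemburg u = 0) : u = 0 := by
  obtain ⟨C, hC, hle⟩ := lintegral_enorm_le G I
  have key : ∀ ε : ℝ, 0 < ε → ∫⁻ t, ‖u t‖ₑ ∂I.measure ≤ ENNReal.ofReal ε * (C + 1) := by
    intro ε hε
    obtain ⟨α, hα, hαlt, h1⟩ := exists_lt_of_luxemburg_lt (u := u) (r := ε) (by linarith)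
    have h2 := (hle (fun t => α⁻¹ • u t)).trans (add_le_add_right h1 C)
    have h3 : ∫⁻ t, ‖u t‖ₑ ∂I.measure =
        ENNReal.ofReal α * ∫⁻ t, ‖α⁻¹ • u t‖ₑ ∂I.measure := by
      rw [← lintegral_const_mul' _ _ ENNReal.ofReal_ne_top]
      refine lintegral_congr fun t => ?_
      rw [← ofReal_norm, ← ofReal_norm, ← ENNReal.ofReal_mul hα.le, norm_smul, norm_inv,
        Real.norm_of_nonneg hα.le, ← mul_assoc, mul_inv_cancel₀ hα.ne', one_mul]
    rw [h3]
    exact mul_le_mul' (ENNReal.ofReal_le_ofReal hαlt.le) h2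
  have hC1 : C + 1 ≠ ⊤ := ENNReal.add_ne_top.2 ⟨hC.ne, ENNReal.one_ne_top⟩
  have hzero : ∫⁻ t, ‖u t‖ₑ ∂I.measure = 0 := by
    have hlim : Tendsto (fun ε : ℝ => ENNReal.ofReal ε * (C + 1)) (𝓝[>] 0) (𝓝 0) := by
      have h1 : Tendsto (fun ε : ℝ => ENNReal.ofReal ε) (𝓝[>] 0) (𝓝 0) := by
        have := (ENNReal.continuous_ofReal.tendsto 0).mono_left
          (nhdsWithin_le_nhds (s := Ioi (0 : ℝ)))
        simpa using this
      simpa using ENNReal.Tendsto.mul_const h1 (Or.inr hC1)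
    refine le_antisymm (ge_of_tendsto hlim ?_) zero_le
    filter_upwards [self_mem_nhdsWithin] with ε hε
    exact key ε hε
  refine ext_ae ?_
  have h0 := (lintegral_eq_zero_iff' u.aesm.enorm).1 hzero
  filter_upwards [h0, AEEqFun.coeFn_zero (α := ℝ) (β := Vec N) (μ := I.measure)] with t ht ht'
  change u t = (0 : ℝ →ₘ[I.measure] Vec N) t
  rw [ht']
  simpa using ht

/-- `w` is the weak derivative of `u` on the interval: `∫_I φ' u dt = - ∫_I φ w dt` for all
`φ ∈ C_c^∞`. All integrals converge because `L^G(I) ⊆ L^1(I)` (see `OrliczSpace.integrable`). -/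
def HasWeakDeriv (u w : OrliczSpace G I) : Prop :=
  ∀ φ : ℝ → ℝ, ContDiff ℝ ∞ φ → HasCompactSupport φ → tsupport φ ⊆ Ioo I.left I.right →
    ∫ t, deriv φ t • u t ∂I.measure = -∫ t, φ t • w t ∂I.measure

theorem integrable_test {φ : ℝ → ℝ} (h : Continuous φ) (h' : HasCompactSupport φ)
    (u : OrliczSpace G I) : Integrable (fun t => φ t • u t) I.measure :=
  u.integrable.locallyIntegrable.integrable_smul_left_of_hasCompactSupport h h'

theorem integral_test_add {φ : ℝ → ℝ} (h : Continuous φ) (h' : HasCompactSupport φ)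
    (u v : OrliczSpace G I) : ∫ t, φ t • (u + v) t ∂I.measure =
      ∫ t, φ t • u t ∂I.measure + ∫ t, φ t • v t ∂I.measure := by
  rw [← integral_add (integrable_test h h' u) (integrable_test h h' v)]
  refine integral_congr_ae ?_
  filter_upwards [coe_add u v] with t ht
  rw [ht, smul_add]

theorem integral_test_smul (φ : ℝ → ℝ) (c : ℝ) (u : OrliczSpace G I) :
    ∫ t, φ t • (c • u) t ∂I.measure = c • ∫ t, φ t • u t ∂I.measure := by
  rw [← integral_smul]
  refine integral_congr_ae ?_
  filter_upwards [coe_smul c u] with t ht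
  rw [ht, smul_comm]

theorem HasWeakDeriv.add {u v w z : OrliczSpace G I} (h : HasWeakDeriv u w)
    (h' : HasWeakDeriv v z) : HasWeakDeriv (u + v) (w + z) := by
  intro φ h1 h2 h3
  rw [integral_test_add (h1.continuous_deriv (by simp)) h2.deriv,
    integral_test_add h1.continuous h2, h φ h1 h2 h3, h' φ h1 h2 h3, neg_add]

theorem HasWeakDeriv.smul {u w : OrliczSpace G I} (c : ℝ) (h : HasWeakDeriv u w) :
    HasWeakDeriv (c • u) (c • w) := by
  intro φ h1 h2 h3
  rw [integral_test_smul, integral_test_smul, h φ h1 h2 h3, smul_neg]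

theorem HasWeakDeriv.unique {u w z : OrliczSpace G I} (h : HasWeakDeriv u w)
    (h' : HasWeakDeriv u z) : w = z := by
  have hint : Integrable (fun t => w t - z t) I.measure := w.integrable.sub z.integrable
  have key := isOpen_Ioo.ae_eq_zero_of_integral_contDiff_smul_eq_zero
    (U := Ioo I.left I.right) (hint.locallyIntegrable.locallyIntegrableOn _) (by
      intro φ h1 h2 h3
      simp only [smul_sub]
      rw [integral_sub (integrable_test h1.continuous h2 w) (integrable_test h1.continuous h2 z),
        sub_eq_zero]
      exact neg_injective ((h φ h1 h2 h3).symm.trans (h' φ h1 h2 h3)))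
  refine ext_ae ?_
  have hmem : ∀ᵐ t ∂I.measure, t ∈ Ioo I.left I.right := by
    refine ae_mono (Measure.restrict_mono_set volume I.subset_Icc) ?_
    rw [restrict_Ioo_eq_restrict_Icc.symm]
    exact ae_restrict_mem measurableSet_Ioo
  filter_upwards [key, hmem] with t ht ht'
  exact sub_eq_zero.1 (ht ht')

end OrliczSpace

open OrliczSpace in
/-- `{u ∈ L^G : u' ∈ L^G}`, where `u'` is the weak derivative, as a linear subspace of `L^G`. -/
def sobolevSubmodule (G : GFunction N) (I : FiniteInterval) : Submodule ℝ (OrliczSpace G I) where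
  carrier := {u | ∃ w : OrliczSpace G I, HasWeakDeriv u w}
  add_mem' := by
    rintro u v ⟨w, hw⟩ ⟨z, hz⟩
    exact ⟨w + z, hw.add hz⟩
  zero_mem' := ⟨(0 : ℝ) • 0, by
    have h : HasWeakDeriv ((0 : ℝ) • (0 : OrliczSpace G I)) ((0 : ℝ) • 0) := by
      intro φ _ _ _
      rw [integral_test_smul, integral_test_smul]
      simp
    simpa using h⟩
  smul_mem' := by
    rintro c u ⟨w, hw⟩
    exact ⟨c • w, hw.smul c⟩

/-- The anisotropic Orlicz–Sobolev space `W^1 L^G(I, ℝ^N)`. -/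
def OrliczSobolev (G : GFunction N) (I : FiniteInterval) : Type := ↥(sobolevSubmodule G I)

namespace OrliczSobolev

variable {G : GFunction N} {I : FiniteInterval}

instance : AddCommGroup (OrliczSobolev G I) :=
  inferInstanceAs (AddCommGroup ↥(sobolevSubmodule G I))

instance : Module ℝ (OrliczSobolev G I) :=
  inferInstanceAs (Module ℝ ↥(sobolevSubmodule G I))

/-- `u` itself, as an element of `L^G`. -/
def val (u : OrliczSobolev G I) : OrliczSpace G I := Subtype.val u

/-- The weak derivative of `u`, as an element of `L^G`. -/
def dot (u : OrliczSobolev G I) : OrliczSpace G I := Classical.choose u.2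

theorem hasWeakDeriv_dot (u : OrliczSobolev G I) : OrliczSpace.HasWeakDeriv u.val u.dot :=
  Classical.choose_spec u.2

theorem val_add (u v : OrliczSobolev G I) : (u + v).val = u.val + v.val := rfl

theorem val_smul (c : ℝ) (u : OrliczSobolev G I) : (c • u).val = c • u.val := rfl

theorem dot_add (u v : OrliczSobolev G I) : (u + v).dot = u.dot + v.dot :=
  (u + v).hasWeakDeriv_dot.unique (u.hasWeakDeriv_dot.add v.hasWeakDeriv_dot)

theorem dot_smul (c : ℝ) (u : OrliczSobolev G I) : (c • u).dot = c • u.dot :=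
  (c • u).hasWeakDeriv_dot.unique (u.hasWeakDeriv_dot.smul c)

/-- The norm `‖u‖ = ‖u‖_{L^G} + ‖u'‖_{L^G}`. -/
instance : Norm (OrliczSobolev G I) :=
  ⟨fun u => OrliczSpace.luxemburg u.val + OrliczSpace.luxemburg u.dot⟩

theorem norm_def (u : OrliczSobolev G I) :
    ‖u‖ = OrliczSpace.luxemburg u.val + OrliczSpace.luxemburg u.dot := rfl

theorem core : NormedSpace.Core ℝ (OrliczSobolev G I) where
  norm_nonneg u := add_nonneg (OrliczSpace.luxemburg_nonneg _) (OrliczSpace.luxemburg_nonneg _)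
  norm_smul c u := by
    rw [norm_def, norm_def, val_smul, dot_smul, OrliczSpace.luxemburg_smul,
      OrliczSpace.luxemburg_smul, Real.norm_eq_abs, mul_add]
  norm_triangle u v := by
    rw [norm_def, norm_def, norm_def, val_add, dot_add]
    linarith [OrliczSpace.luxemburg_add_le u.val v.val, OrliczSpace.luxemburg_add_le u.dot v.dot]
  norm_eq_zero_iff u := by
    constructor
    · intro h
      rw [norm_def] at h
      refine Subtype.ext (OrliczSpace.eq_zero_of_luxemburg (u := u.val) ?_)
      linarith [OrliczSpace.luxemburg_nonneg u.val, OrliczSpace.luxemburg_nonneg u.dot]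
    · rintro rfl
      have h1 : (0 : OrliczSobolev G I).val = 0 := rfl
      have h2 : (0 : OrliczSobolev G I).dot = 0 := by
        have := dot_smul (0 : ℝ) (0 : OrliczSobolev G I)
        simpa using this
      rw [norm_def, h1, h2, OrliczSpace.luxemburg_zero, add_zero]

instance : NormedAddCommGroup (OrliczSobolev G I) := NormedAddCommGroup.ofCore core

instance : NormedSpace ℝ (OrliczSobolev G I) := NormedSpace.ofCore core

end OrliczSobolev

/-- The functional `u ↦ ∫_I F(t, u(t), u'(t)) dt` on `W^1 L^G(I, ℝ^N)`. -/
def lagrangianFunctional (G : GFunction N) (I : FiniteInterval) (F : ℝ → Vec N → Vec N → ℝ)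
    (u : OrliczSobolev G I) : ℝ :=
  ∫ t, F t (u.val t) (u.dot t) ∂I.measure

/-- The partial gradient `F_x(t, x, v)`. -/
def gradX (F : ℝ → Vec N → Vec N → ℝ) (t : ℝ) (x v : Vec N) : Vec N :=
  gradient (fun y => F t y v) x

/-- The partial gradient `F_v(t, x, v)`. -/
def gradV (F : ℝ → Vec N → Vec N → ℝ) (t : ℝ) (x v : Vec N) : Vec N :=
  gradient (fun y => F t x y) v

end

/-! The strategy is to find the Gateaux derivative of the functional and to show that it depends
continuously on the point; a continuous Gateaux derivative is a Fréchet derivative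
(`hasFDerivAt_of_hasLineDerivAt`).

Three facts make the growth conditions usable. The embedding of `W^1 L^G` in `L^∞`
(`exists_ae_norm_le`) keeps `u` bounded, so that `a(|u|)` is bounded by a constant. The conjugate
grows in a controlled way: `∇₂` for `G` is `Δ₂` for `G*`, and `G*(∇G v) ≤ G(2v)` by convexity,
whence `G*(k F_v) ≤ m + A G(v)` for every fixed `k` (`exists_growth`). Finally, Young's inequality
turns bounds on `∫ G*(k Q)` into bounds on `φ ↦ ∫ ⟨Q, φ'⟩` (`abs_integral_inner_le`), with no need
for a norm on the dual Orlicz space.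

Differentiation under the integral along a line gives the Gateaux derivative (`hasLineDerivAt`). For
continuity it is enough to treat sequences with `‖v n - u‖ < 2^{-(n+1)}`. For these, `∑ G(2(v n -
u)')` is integrable, so the `G((v n)')` have a common integrable majorant and the derivatives
converge a.e. (`exists_dominated`). Dominated convergence then sends `∫ |F_x(v n) - F_x(u)|` and `∫
G*(k (F_v(v n) - F_v(u)))` to `0` for each `k`. The resulting bound on the operator norm tends to
`1/k`, and `k` is arbitrary. -/

namespace GFunction

variable {N : ℕ} (G : GFunction N)

/-! ### Convexity estimates for `G` and growth of the conjugate -/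

theorem le_smul_of_one_le {k : ℝ} (hk : 1 ≤ k) (x : Vec N) : k * G x ≤ G (k • x) := by
  have hk0 : 0 < k := by linarith
  have h := G.smul_le (c := k⁻¹) (by positivity) (inv_le_one_of_one_le₀ hk) (k • x)
  rw [smul_smul, inv_mul_cancel₀ hk0.ne', one_smul] at h
  rwa [← le_inv_mul_iff₀ hk0]

theorem add_le (x y : Vec N) : G (x + y) ≤ G ((2 : ℝ) • x) + G ((2 : ℝ) • y) := by
  have h := G.convex.2 (mem_univ ((2 : ℝ) • x)) (mem_univ ((2 : ℝ) • y))
    (show (0 : ℝ) ≤ 1 / 2 by norm_num) (show (0 : ℝ) ≤ 1 / 2 by norm_num) (by norm_num)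
  simp only [smul_smul, smul_eq_mul] at h
  norm_num at h
  linarith [G.nonneg ((2 : ℝ) • x), G.nonneg ((2 : ℝ) • y)]

/-- The Fenchel–Young inequality. -/
theorem inner_le (x y : Vec N) : inner ℝ x y ≤ G x + G.conj y := by
  have := le_ciSup (G.bddAbove_conj y) x
  unfold conj
  linarith

theorem abs_inner_le (x y : Vec N) : |inner ℝ x y| ≤ G x + G.conj y := by
  refine abs_le'.2 ⟨G.inner_le x y, ?_⟩
  have h := G.inner_le (-x) y
  rwa [inner_neg_left, G.even] at h

theorem conj_le {y : Vec N} {r : ℝ} (h : ∀ x, inner ℝ x y - G x ≤ r) : G.conj y ≤ r :=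
  ciSup_le h

theorem conj_nonneg (y : Vec N) : 0 ≤ G.conj y := by
  have := G.inner_le 0 y
  simpa [G.map_zero] using this

theorem conj_zero : G.conj 0 = 0 :=
  le_antisymm (G.conj_le fun x => by simp [G.nonneg x]) (G.conj_nonneg 0)

theorem conj_neg (y : Vec N) : G.conj (-y) = G.conj y := by
  have key : ∀ y, G.conj (-y) ≤ G.conj y := fun y => G.conj_le fun x => by
    have := G.inner_le (-x) y
    rw [G.even, inner_neg_left] at this
    rw [inner_neg_right]
    linarith
  exact le_antisymm (key y) (by simpa using key (-y))

theorem convexOn_conj : ConvexOn ℝ univ G.conj := by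
  refine ⟨convex_univ, fun y _ z _ p q hp hq hpq => G.conj_le fun x => ?_⟩
  have h1 := mul_le_mul_of_nonneg_left (G.inner_le x y) hp
  have h2 := mul_le_mul_of_nonneg_left (G.inner_le x z) hq
  have h3 : G x = p * G x + q * G x := by rw [← add_mul, hpq, one_mul]
  rw [inner_add_right, inner_smul_right, inner_smul_right, smul_eq_mul, smul_eq_mul]
  linarith

theorem continuous_conj : Continuous G.conj := G.convexOn_conj.locallyLipschitz.continuous

theorem conj_smul_le {c : ℝ} (h0 : 0 ≤ c) (h1 : c ≤ 1) (y : Vec N) :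
    G.conj (c • y) ≤ c * G.conj y := by
  have h := G.convexOn_conj.2 (mem_univ y) (mem_univ (0 : Vec N)) h0 (sub_nonneg.2 h1) (by ring)
  simpa [G.conj_zero] using h

/-- Convexity at the midpoint of `2x` and `-2y`, with the factors `1/2` dropped. It reduces
differences of `F_v` to the growth bound for `F_v` itself. -/
theorem conj_sub_le (x y : Vec N) :
    G.conj (x - y) ≤ G.conj ((2 : ℝ) • x) + G.conj ((2 : ℝ) • y) := by
  have h := G.convexOn_conj.2 (mem_univ ((2 : ℝ) • x)) (mem_univ (-((2 : ℝ) • y)))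
    (show (0 : ℝ) ≤ 1 / 2 by norm_num) (show (0 : ℝ) ≤ 1 / 2 by norm_num) (by norm_num)
  simp only [smul_smul, smul_neg, smul_eq_mul, conj_neg] at h
  norm_num at h
  rw [← sub_eq_add_neg] at h
  linarith [G.conj_nonneg ((2 : ℝ) • x), G.conj_nonneg ((2 : ℝ) • y)]

/-- The `∇₂` condition on `G` gives the `Δ₂` condition on the conjugate. -/
theorem exists_conj_two_smul_le :
    ∃ C K : ℝ, 0 ≤ C ∧ 0 ≤ K ∧ ∀ y, G.conj ((2 : ℝ) • y) ≤ C + K * G.conj y := by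
  obtain ⟨K, hK, M, hM, h⟩ := G.nabla2
  obtain ⟨C, hC⟩ := (isCompact_closedBall (0 : Vec N) M).bddAbove_image G.continuous.continuousOn
  have hK0 : 0 < K := by linarith
  have key : ∀ x, G x ≤ |C| + 1 / (2 * K) * G (K • x) := by
    intro x
    by_cases hx : M ≤ ‖x‖
    · linarith [h x hx, abs_nonneg C]
    · have h1 : G x ≤ C := hC ⟨x, by simpa using (not_le.1 hx).le, rfl⟩
      have h2 : 0 ≤ 1 / (2 * K) * G (K • x) := mul_nonneg (by positivity) (G.nonneg _)
      linarith [le_abs_self C]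
  -- Young's inequality for `x / K` and `y`, with `G(x / K) ≤ |C| + G(x) / (2K)`, is multiplied by
  -- `2K`. This brings the coefficient of `G(x)` to exactly `1` and that of `⟨x, y⟩` to `2`.
  refine ⟨2 * K * |C|, 2 * K, by positivity, by positivity, fun y => G.conj_le fun x => ?_⟩
  have h1 := key (K⁻¹ • x)
  rw [smul_smul, mul_inv_cancel₀ hK0.ne', one_smul] at h1
  have h2 := G.inner_le (K⁻¹ • x) y
  rw [real_inner_smul_left] at h2
  rw [real_inner_smul_right]
  have h3 := mul_le_mul_of_nonneg_left (h2.trans (add_le_add_left h1 _))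
    (show 0 ≤ 2 * K by positivity)
  have h4 : 2 * K * (K⁻¹ * inner ℝ x y) = 2 * inner ℝ x y := by field_simp
  have h5 : 2 * K * (|C| + 1 / (2 * K) * G x + G.conj y) =
      2 * K * |C| + G x + 2 * K * G.conj y := by field_simp
  linarith

theorem exists_conj_smul_le {c : ℝ} (hc : 0 ≤ c) :
    ∃ C K : ℝ, 0 ≤ C ∧ 0 ≤ K ∧ ∀ y, G.conj (c • y) ≤ C + K * G.conj y := by
  have hpow : ∀ n : ℕ, ∃ C K : ℝ, 0 ≤ C ∧ 0 ≤ K ∧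
      ∀ y, G.conj ((2 : ℝ) ^ n • y) ≤ C + K * G.conj y := by
    intro n
    induction n with
    | zero => exact ⟨0, 1, le_rfl, zero_le_one, fun x => by simp⟩
    | succ n ih =>
      obtain ⟨C, K, hC, hK, h⟩ := ih
      obtain ⟨C', K', hC', hK', h'⟩ := G.exists_conj_two_smul_le
      refine ⟨C' + K' * C, K' * K, by positivity, by positivity, fun x => ?_⟩
      have h1 := h' ((2 : ℝ) ^ n • x)
      rw [smul_smul, ← pow_succ'] at h1
      nlinarith [mul_le_mul_of_nonneg_left (h x) hK']
  obtain ⟨n, hn⟩ := pow_unbounded_of_one_lt c (one_lt_two : (1 : ℝ) < 2)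
  obtain ⟨C, K, hC, hK, h⟩ := hpow n
  refine ⟨C, K, hC, hK, fun y => le_trans ?_ (h y)⟩
  have h2 : (0 : ℝ) < 2 ^ n := by positivity
  have h3 := G.conj_smul_le (c := c / 2 ^ n) (by positivity) ((div_le_one h2).2 hn.le)
    ((2 : ℝ) ^ n • y)
  rw [smul_smul, div_mul_cancel₀ _ h2.ne'] at h3
  exact h3.trans (mul_le_of_le_one_left (G.conj_nonneg _) ((div_le_one h2).2 hn.le))

/-- A convex function lies above its tangent: on the segment from `v` to `x` the slope over `[0, 1]`
is at least the derivative at `0`. -/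
theorem inner_gradient_le (hG : Differentiable ℝ (G : Vec N → ℝ)) (v x : Vec N) :
    inner ℝ (x - v) (gradient (G : Vec N → ℝ) v) ≤ G x - G v := by
  have hconv : ConvexOn ℝ univ ((G : Vec N → ℝ) ∘ (AffineMap.lineMap v x : ℝ →ᵃ[ℝ] Vec N)) :=
    G.convex.comp_affineMap (AffineMap.lineMap v x)
  have hd : HasDerivAt ((G : Vec N → ℝ) ∘ (AffineMap.lineMap v x : ℝ →ᵃ[ℝ] Vec N))
      (inner ℝ (x - v) (gradient (G : Vec N → ℝ) v)) 0 := by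
    have h1 : HasFDerivAt (G : Vec N → ℝ)
        (InnerProductSpace.toDual ℝ (Vec N) (gradient (G : Vec N → ℝ) v))
        (AffineMap.lineMap v x (0 : ℝ)) := by
      rw [AffineMap.lineMap_apply_zero]
      exact (hG v).hasGradientAt.hasFDerivAt
    have h2 := h1.comp_hasDerivAt (0 : ℝ)
      (AffineMap.hasDerivAt_lineMap (a := v) (b := x) (x := (0 : ℝ)))
    rwa [InnerProductSpace.toDual_apply_apply, real_inner_comm] at h2
  have h := hconv.le_slope_of_hasDerivAt (mem_univ 0) (mem_univ 1) zero_lt_one hd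
  simpa [slope_def_field] using h

/-- The tangent inequality bounds the conjugate at `∇G v` by `⟨v, ∇G v⟩ - G v`; the same inequality
at the point `2v` bounds `⟨v, ∇G v⟩` by `G(2v) - G v`. This converts the right-hand side of the
hypothesis on `F_v` into a multiple of `G`. -/
theorem conj_gradient_le (hG : Differentiable ℝ (G : Vec N → ℝ)) (v : Vec N) :
    G.conj (gradient (G : Vec N → ℝ) v) ≤ G ((2 : ℝ) • v) := by
  refine G.conj_le fun x => ?_
  have h1 := G.inner_gradient_le hG v x
  have h2 := G.inner_gradient_le hG v ((2 : ℝ) • v)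
  rw [two_smul ℝ v, add_sub_cancel_right, ← two_smul ℝ v] at h2
  rw [inner_sub_left] at h1
  linarith [G.nonneg v]

end GFunction

/-! ### The one-dimensional Sobolev inequality from the weak derivative -/

/-- A smooth function of integral zero supported in an interval has a smooth primitive supported
there. -/
theorem exists_primitive_of_integral_eq_zero {f : ℝ → ℝ} (hf : ContDiff ℝ ∞ f) {p q : ℝ}
    (hsupp : Function.support f ⊆ Ioo p q) (h0 : ∫ t, f t = 0) :
    ∃ Φ : ℝ → ℝ, ContDiff ℝ ∞ Φ ∧ HasCompactSupport Φ ∧ tsupport Φ ⊆ Icc p q ∧ deriv Φ = f ∧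
      ∀ t, |Φ t| ≤ ∫ s, |f s| := by
  have hcs : HasCompactSupport f :=
    HasCompactSupport.of_support_subset_isCompact isCompact_Icc (hsupp.trans Ioo_subset_Icc_self)
  have hint : Integrable f := hf.continuous.integrable_of_hasCompactSupport hcs
  have hd : ∀ t, HasDerivAt (fun t => ∫ s in p..t, f s) (f t) t := fun t =>
    intervalIntegral.integral_hasDerivAt_right (hint.intervalIntegrable)
      hf.continuous.stronglyMeasurable.stronglyMeasurableAtFilter hf.continuous.continuousAt
  have hderiv : deriv (fun t => ∫ s in p..t, f s) = f := funext fun t => (hd t).deriv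
  have hts : tsupport (fun t => ∫ s in p..t, f s) ⊆ Icc p q := by
    refine closure_minimal (fun t ht => ?_) isClosed_Icc
    by_contra hmem
    refine ht ?_
    -- To the left of `p` the integrand vanishes; to the right of `q` the primitive is the full
    -- integral, which is zero.
    rcases lt_or_ge t p with h | h
    · refine intervalIntegral.integral_zero_ae (Eventually.of_forall fun s hs => ?_)
      rw [uIoc_of_ge h.le] at hs
      by_contra hne
      exact absurd (hsupp hne).1 (not_lt.2 hs.2)
    · have hq : q < t := by
        by_contra hle
        exact hmem ⟨h, not_lt.1 hle⟩
      change ∫ s in p..t, f s = 0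
      rw [intervalIntegral.integral_eq_integral_of_support_subset, h0]
      exact fun s hs => ⟨(hsupp hs).1, (hsupp hs).2.le.trans hq.le⟩
  refine ⟨fun t => ∫ s in p..t, f s, ?_, ?_, hts, hderiv, fun t => ?_⟩
  · refine contDiff_infty_iff_deriv.2 ⟨fun t => (hd t).differentiableAt, ?_⟩
    rwa [hderiv]
  · exact HasCompactSupport.of_support_subset_isCompact isCompact_Icc
      ((subset_tsupport _).trans hts)
  · refine (intervalIntegral.norm_integral_le_integral_norm_uIoc
      (f := f) (a := p) (b := t) (μ := volume)).trans ?_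
    exact setIntegral_le_integral hint.norm (Eventually.of_forall fun s => norm_nonneg _)

/-- The endpoints are null, so the whole argument can run on the open interval. -/
theorem FiniteInterval.measure_eq (I : FiniteInterval) :
    I.measure = volume.restrict (Ioo I.left I.right) := by
  refine le_antisymm ?_ (Measure.restrict_mono_set volume I.Ioo_subset)
  rw [restrict_Ioo_eq_restrict_Icc]
  exact Measure.restrict_mono_set volume I.subset_Icc

theorem FiniteInterval.integral_eq {E : Type*} [NormedAddCommGroup E] [NormedSpace ℝ E]
    (I : FiniteInterval) (f : ℝ → E) :
    ∫ t, f t ∂I.measure = ∫ t in Ioo I.left I.right, f t := by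
  rw [I.measure_eq]

theorem FiniteInterval.ae_mem_Ioo (I : FiniteInterval) :
    ∀ᵐ t ∂I.measure, t ∈ Ioo I.left I.right := by
  rw [I.measure_eq]
  exact ae_restrict_mem measurableSet_Ioo

namespace OrliczSpace

variable {N : ℕ} {G : GFunction N} {I : FiniteInterval}

/-- Averages of `u` against two probability densities differ by at most `2 ‖u'‖₁`. -/
theorem HasWeakDeriv.norm_integral_smul_le {u w : OrliczSpace G I} (h : HasWeakDeriv u w)
    {φ ψ : ℝ → ℝ} (hφ : ContDiff ℝ ∞ φ) (hψ : ContDiff ℝ ∞ ψ) {p q : ℝ} (hp : I.left < p)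
    (hq : q < I.right) (hφs : Function.support φ ⊆ Ioo p q) (hψs : Function.support ψ ⊆ Ioo p q)
    (hφ0 : ∀ t, 0 ≤ φ t) (hψ0 : ∀ t, 0 ≤ ψ t) (hφ1 : ∫ t, φ t = 1) (hψ1 : ∫ t, ψ t = 1) :
    ‖∫ t, φ t • u t ∂I.measure‖ ≤
      ‖∫ t, ψ t • u t ∂I.measure‖ + 2 * ∫ t, ‖w t‖ ∂I.measure := by
  have hφc : HasCompactSupport φ :=
    HasCompactSupport.of_support_subset_isCompact isCompact_Icc (hφs.trans Ioo_subset_Icc_self)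
  have hψc : HasCompactSupport ψ :=
    HasCompactSupport.of_support_subset_isCompact isCompact_Icc (hψs.trans Ioo_subset_Icc_self)
  have hφi : Integrable φ := hφ.continuous.integrable_of_hasCompactSupport hφc
  have hψi : Integrable ψ := hψ.continuous.integrable_of_hasCompactSupport hψc
  -- Both densities have mass one, so `φ - ψ` has a compactly supported primitive `Φ`. It is an
  -- admissible test function, and the weak derivative gives `∫ (φ - ψ) u = -∫ Φ w` with `|Φ| ≤ ‖φ -
  -- ψ‖₁ ≤ 2`.
  obtain ⟨Φ, h1, h2, h3, h4, h5⟩ := exists_primitive_of_integral_eq_zero (f := fun t => φ t - ψ t)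
    (hφ.sub hψ) (p := p) (q := q)
    ((Function.support_sub φ ψ).trans (union_subset hφs hψs))
    (by rw [integral_sub hφi hψi, hφ1, hψ1, sub_self])
  have h6 := h Φ h1 h2 (h3.trans fun t ht => ⟨hp.trans_le ht.1, ht.2.trans_lt hq⟩)
  rw [h4] at h6
  simp only [sub_smul] at h6
  rw [integral_sub (integrable_test hφ.continuous hφc u) (integrable_test hψ.continuous hψc u)] at h6
  have h7 : ∀ t, |Φ t| ≤ 2 := by
    intro t
    refine (h5 t).trans ?_
    calc ∫ s, |φ s - ψ s| ≤ ∫ s, (φ s + ψ s) := by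
          refine integral_mono (hφi.sub hψi).abs (hφi.add hψi) fun s => ?_
          have := hφ0 s
          have := hψ0 s
          exact abs_le.2 ⟨by linarith, by linarith⟩
      _ = 2 := by rw [integral_add hφi hψi, hφ1, hψ1]; norm_num
  have h8 : ‖∫ t, Φ t • w t ∂I.measure‖ ≤ 2 * ∫ t, ‖w t‖ ∂I.measure := by
    refine (norm_integral_le_integral_norm _).trans ?_
    rw [← integral_const_mul]
    refine integral_mono (integrable_test h1.continuous h2 w).norm (w.integrable.norm.const_mul 2)
      fun t => ?_
    change ‖Φ t • w t‖ ≤ 2 * ‖w t‖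
    rw [norm_smul]
    exact mul_le_mul_of_nonneg_right (h7 t) (norm_nonneg _)
  have h9 : ∫ t, φ t • u t ∂I.measure =
      ∫ t, ψ t • u t ∂I.measure - ∫ t, Φ t • w t ∂I.measure := by
    rw [sub_eq_iff_eq_add.1 h6]
    abel
  rw [h9]
  exact (norm_sub_le _ _).trans (add_le_add_right h8 _)

/-- The Sobolev inequality in dimension one. -/
theorem exists_ae_norm_le_of_hasWeakDeriv (G : GFunction N) (I : FiniteInterval) :
    ∃ C : ℝ, 0 ≤ C ∧ ∀ u w : OrliczSpace G I, HasWeakDeriv u w → ∀ᵐ t ∂I.measure,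
      ‖u t‖ ≤ C * (∫ t, ‖u t‖ ∂I.measure + ∫ t, ‖w t‖ ∂I.measure) := by
  have hlr := I.left_lt_right
  -- A fixed reference density in the middle of the interval. The average of `u` against it is at
  -- most `B ‖u‖₁`, and every other average differs from it by at most `2 ‖w‖₁`.
  let β : ContDiffBump ((I.left + I.right) / 2) :=
    ⟨(I.right - I.left) / 8, (I.right - I.left) / 4, by linarith, by linarith⟩
  have hβc : HasCompactSupport (β.normed volume) := β.hasCompactSupport_normed
  obtain ⟨B, hB⟩ := hβc.exists_bound_of_continuous β.continuous_normed
  have hB0 : 0 ≤ B := (norm_nonneg _).trans (hB 0)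
  refine ⟨B + 2, by positivity, fun u w h => ?_⟩
  have hβu : ‖∫ t, β.normed volume t • u t ∂I.measure‖ ≤ B * ∫ t, ‖u t‖ ∂I.measure := by
    refine (norm_integral_le_integral_norm _).trans ?_
    rw [← integral_const_mul]
    refine integral_mono (integrable_test β.continuous_normed hβc u).norm
      (u.integrable.norm.const_mul B) fun t => ?_
    change ‖β.normed volume t • u t‖ ≤ B * ‖u t‖
    rw [norm_smul]
    exact mul_le_mul_of_nonneg_right (hB t) (norm_nonneg _)
  -- Shrinking mollifiers with outer radius twice the inner one, which is the bounded ratio required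
  -- for a.e. convergence of the convolutions. They act on the extension `g` of `u` by zero.
  let φ : ℕ → ContDiffBump (0 : ℝ) := fun n =>
    ⟨1 / ((n : ℝ) + 1) / 2, 1 / ((n : ℝ) + 1), by positivity, half_lt_self (by positivity)⟩
  let g : ℝ → Vec N := (Ioo I.left I.right).indicator u
  have hg : Integrable g := by
    rw [integrable_indicator_iff measurableSet_Ioo, IntegrableOn, ← I.measure_eq]
    exact u.integrable
  have hconv := ContDiffBump.ae_convolution_tendsto_right_of_locallyIntegrable (μ := volume)
    (φ := φ) (l := atTop) (K := 2) tendsto_one_div_add_atTop_nhds_zero_nat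
    (Eventually.of_forall fun n => by simp only [φ]; linarith) hg.locallyIntegrable
  filter_upwards [ae_restrict_of_ae (s := I.carrier) hconv, I.ae_mem_Ioo] with t ht htI
  have hgt : g t = u t := indicator_of_mem htI _
  rw [hgt] at ht
  refine le_of_tendsto ht.norm ?_
  -- Once the radius is below the distance from `t` to the endpoints, the mollifier centred at `t`
  -- is supported inside the interval and can be compared with `β`.
  have hδ : 0 < min (t - I.left) (I.right - t) := lt_min (by linarith [htI.1]) (by linarith [htI.2])
  filter_upwards [tendsto_one_div_add_atTop_nhds_zero_nat.eventually_lt_const hδ] with n hn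
  have hr1 : 1 / ((n : ℝ) + 1) < t - I.left := hn.trans_le (min_le_left _ _)
  have hr2 : 1 / ((n : ℝ) + 1) < I.right - t := hn.trans_le (min_le_right _ _)
  have heq : convolution ((φ n).normed volume) g (ContinuousLinearMap.lsmul ℝ ℝ) volume t =
      ∫ s, (φ n).normed volume (t - s) • u s ∂I.measure := by
    rw [convolution_eq_swap, I.integral_eq, ← integral_indicator measurableSet_Ioo]
    refine integral_congr_ae (Eventually.of_forall fun s => ?_)
    simp only [g, ContinuousLinearMap.lsmul_apply, indicator_smul_apply]
  rw [heq]
  have hsupp : Function.support (fun s => (φ n).normed volume (t - s)) ⊆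
      Ioo (t - 1 / ((n : ℝ) + 1)) (t + 1 / ((n : ℝ) + 1)) := by
    intro s hs
    have : t - s ∈ Function.support ((φ n).normed volume) := hs
    rw [ContDiffBump.support_normed_eq, Metric.mem_ball, Real.dist_eq, sub_zero, abs_lt] at this
    exact ⟨by linarith [this.2], by linarith [this.1]⟩
  have hsuppβ : Function.support (β.normed volume) ⊆
      Ioo ((I.left + I.right) / 2 - (I.right - I.left) / 4)
        ((I.left + I.right) / 2 + (I.right - I.left) / 4) := by
    rw [ContDiffBump.support_normed_eq, Real.ball_eq_Ioo]
  have key := h.norm_integral_smul_le (φ := fun s => (φ n).normed volume (t - s))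
    (ψ := β.normed volume)
    -- The smallest interval containing both supports still lies strictly inside `I`.
    (p := min (t - 1 / ((n : ℝ) + 1)) ((I.left + I.right) / 2 - (I.right - I.left) / 4))
    (q := max (t + 1 / ((n : ℝ) + 1)) ((I.left + I.right) / 2 + (I.right - I.left) / 4))
    ((φ n).contDiff_normed.comp (contDiff_const.sub contDiff_id)) β.contDiff_normed
    (lt_min (by linarith) (by linarith)) (max_lt (by linarith) (by linarith))
    (hsupp.trans (Ioo_subset_Ioo (min_le_left _ _) (le_max_left _ _)))
    (hsuppβ.trans (Ioo_subset_Ioo (min_le_right _ _) (le_max_right _ _)))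
    (fun s => (φ n).nonneg_normed _) (fun s => β.nonneg_normed _)
    (by rw [integral_sub_left_eq_self (fun s => (φ n).normed volume s) volume t]
        exact (φ n).integral_normed)
    β.integral_normed
  have hu0 : 0 ≤ ∫ t, ‖u t‖ ∂I.measure := integral_nonneg fun _ => norm_nonneg _
  have hw0 : 0 ≤ ∫ t, ‖w t‖ ∂I.measure := integral_nonneg fun _ => norm_nonneg _
  nlinarith

end OrliczSpace

/-! ### Modular, Luxemburg norm and Hölder inequality -/

namespace OrliczSpace

variable {N : ℕ} {G : GFunction N} {I : FiniteInterval}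

theorem integrable_comp_smul (u : OrliczSpace G I) (c : ℝ) :
    Integrable (fun t => G (c • u t)) I.measure := by
  refine ⟨G.continuous.comp_aestronglyMeasurable (u.aesm.const_smul c), ?_⟩
  refine lt_of_eq_of_lt (lintegral_congr fun t => ?_) (G.modular_smul_lt_top I c u.2)
  rw [← ofReal_norm, Real.norm_of_nonneg (G.nonneg _)]

theorem integrable_comp (u : OrliczSpace G I) : Integrable (fun t => G (u t)) I.measure := by
  simpa using u.integrable_comp_smul 1

/-- For an admissible `α` with `k α < r ≤ 1`, convexity gives `G(k u) ≤ k α G(u / α)`. Small norms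
thus give linearly small modulars, which is what makes the modulars of a fast sequence summable. -/
theorem modular_smul_le_of_luxemburg_lt {u : OrliczSpace G I} {k r : ℝ} (hk : 0 < k) (hr : r ≤ 1)
    (h : k * luxemburg u < r) : G.modular I (fun t => k • u t) ≤ ENNReal.ofReal r := by
  obtain ⟨α, hα, hαr, h1⟩ := exists_lt_of_luxemburg_lt (show luxemburg u < r / k by
    rwa [lt_div_iff₀' hk])
  rw [lt_div_iff₀' hk] at hαr
  have hkα : 0 ≤ k * α := by positivity
  have h2 : G.modular I (fun t => k • u t) ≤
      ENNReal.ofReal (k * α) * G.modular I (fun t => α⁻¹ • u t) := by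
    unfold GFunction.modular
    rw [← lintegral_const_mul' _ _ ENNReal.ofReal_ne_top]
    refine lintegral_mono fun t => ?_
    rw [← ENNReal.ofReal_mul hkα]
    refine ENNReal.ofReal_le_ofReal ?_
    have h3 := G.smul_le hkα (hαr.le.trans hr) (α⁻¹ • u t)
    rwa [smul_smul, mul_assoc, mul_inv_cancel₀ hα.ne', mul_one] at h3
  calc _ ≤ ENNReal.ofReal (k * α) * 1 := h2.trans (mul_le_mul' le_rfl h1)
    _ ≤ ENNReal.ofReal r := by
      rw [mul_one]
      exact ENNReal.ofReal_le_ofReal hαr.le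

theorem integral_comp_smul_le_one {u : OrliczSpace G I} {c : ℝ}
    (h : G.modular I (fun t => c • u t) ≤ 1) : ∫ t, G (c • u t) ∂I.measure ≤ 1 := by
  rw [integral_eq_lintegral_of_nonneg_ae (Eventually.of_forall fun t => G.nonneg _)
    (u.integrable_comp_smul c).aestronglyMeasurable]
  exact ENNReal.toReal_le_of_le_ofReal zero_le_one (by rwa [ENNReal.ofReal_one])

/-- If `A` bounds the functional `r ↦ r * A` on every `r` admissible in the Luxemburg norm. -/
theorem le_mul_luxemburg {u : OrliczSpace G I} {x A : ℝ}
    (h : ∀ α : ℝ, 0 < α → ∫ t, G (α⁻¹ • u t) ∂I.measure ≤ 1 → x ≤ A * α) (hA : 0 < A) :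
    x ≤ A * luxemburg u := by
  rw [← div_le_iff₀' hA]
  refine le_csInf (luxemburg_set_nonempty u) fun α hα => ?_
  rw [div_le_iff₀' hA]
  exact h α hα.1 (integral_comp_smul_le_one hα.2)

theorem exists_integral_norm_le (G : GFunction N) (I : FiniteInterval) :
    ∃ C : ℝ, 0 ≤ C ∧ ∀ u : OrliczSpace G I, ∫ t, ‖u t‖ ∂I.measure ≤ C * luxemburg u := by
  obtain ⟨R, hR0, hR⟩ := G.exists_linear_le 1
  refine ⟨∫ _, R ∂I.measure + 1, by positivity, fun u => le_mul_luxemburg (fun α hα h => ?_) ?_⟩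
  · have h1 : ∫ t, ‖α⁻¹ • u t‖ ∂I.measure ≤ ∫ t, (R + G (α⁻¹ • u t)) ∂I.measure := by
      refine integral_mono (u.integrable.smul α⁻¹).norm
        ((integrable_const R).add (u.integrable_comp_smul _)) fun t => ?_
      have := hR (α⁻¹ • u t)
      change ‖α⁻¹ • u t‖ ≤ R + G (α⁻¹ • u t)
      linarith
    rw [integral_add (integrable_const R) (u.integrable_comp_smul _)] at h1
    simp only [norm_smul, norm_inv, Real.norm_of_nonneg hα.le] at h1
    rw [integral_const_mul, inv_mul_le_iff₀ hα] at h1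
    refine h1.trans ?_
    rw [mul_comm]
    gcongr
  · have : 0 ≤ ∫ _, R ∂I.measure := integral_nonneg fun _ => hR0
    linarith

/-- The Hölder inequality: integrability. -/
theorem integrable_inner {Q : ℝ → Vec N} (hQ : AEStronglyMeasurable Q I.measure)
    (hint : Integrable (fun t => G.conj (Q t)) I.measure) (w : OrliczSpace G I) :
    Integrable (fun t => inner ℝ (Q t) (w t)) I.measure := by
  refine (w.integrable_comp.add hint).mono' (hQ.inner w.aesm) (Eventually.of_forall fun t => ?_)
  rw [Real.norm_eq_abs, real_inner_comm]
  exact G.abs_inner_le _ _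

/-- The Hölder inequality. -/
theorem abs_integral_inner_le {Q : ℝ → Vec N} (hQ : AEStronglyMeasurable Q I.measure) {k : ℝ}
    (hk : 0 < k) (hint : Integrable (fun t => G.conj (k • Q t)) I.measure) (w : OrliczSpace G I) :
    |∫ t, inner ℝ (Q t) (w t) ∂I.measure| ≤
      k⁻¹ * (∫ t, G.conj (k • Q t) ∂I.measure + 1) * luxemburg w := by
  have h0 : 0 ≤ ∫ t, G.conj (k • Q t) ∂I.measure := integral_nonneg fun t => G.conj_nonneg _
  refine le_mul_luxemburg (fun α hα h => ?_) (by positivity)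
  calc |∫ t, inner ℝ (Q t) (w t) ∂I.measure|
      ≤ ∫ t, |inner ℝ (Q t) (w t)| ∂I.measure := abs_integral_le_integral_abs
    _ ≤ ∫ t, k⁻¹ * α * (G.conj (k • Q t) + G (α⁻¹ • w t)) ∂I.measure := by
        have hi : Integrable (fun t => k⁻¹ * α * (G.conj (k • Q t) + G (α⁻¹ • w t))) I.measure :=
          (hint.add (w.integrable_comp_smul _)).const_mul _
        have hle : ∀ t, |inner ℝ (Q t) (w t)| ≤
            k⁻¹ * α * (G.conj (k • Q t) + G (α⁻¹ • w t)) := by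
          intro t
          -- Young's inequality is applied to rescaled vectors. The free parameter `k` leaves a
          -- factor `k⁻¹` that can be made small as long as `∫ G*(k Q)` stays bounded.
          have h1 := G.abs_inner_le (α⁻¹ • w t) (k • Q t)
          rw [real_inner_smul_left, real_inner_smul_right, abs_mul, abs_mul, abs_inv,
            abs_of_pos hα, abs_of_pos hk, real_inner_comm, inv_mul_le_iff₀ hα] at h1
          rw [mul_assoc, le_inv_mul_iff₀ hk]
          linarith
        exact integral_mono (hi.mono' (hQ.inner w.aesm) (Eventually.of_forall hle)).abs hi hle
    _ = k⁻¹ * (∫ t, G.conj (k • Q t) ∂I.measure + ∫ t, G (α⁻¹ • w t) ∂I.measure) * α := by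
        rw [integral_const_mul, integral_add hint (w.integrable_comp_smul _)]
        ring
    _ ≤ _ := by gcongr

end OrliczSpace

/-! ### Embedding in `L^∞`, pairings and dominated sequences -/

namespace OrliczSobolev

variable {N : ℕ} {G : GFunction N} {I : FiniteInterval}

theorem luxemburg_dot_le (u : OrliczSobolev G I) : OrliczSpace.luxemburg u.dot ≤ ‖u‖ := by
  rw [norm_def]
  linarith [OrliczSpace.luxemburg_nonneg u.val]

theorem ae_val_add (u v : OrliczSobolev G I) :
    ∀ᵐ t ∂I.measure, (u + v).val t = u.val t + v.val t := by
  rw [val_add]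
  exact OrliczSpace.coe_add _ _

theorem ae_dot_add (u v : OrliczSobolev G I) :
    ∀ᵐ t ∂I.measure, (u + v).dot t = u.dot t + v.dot t := by
  rw [dot_add]
  exact OrliczSpace.coe_add _ _

theorem ae_val_smul (c : ℝ) (u : OrliczSobolev G I) :
    ∀ᵐ t ∂I.measure, (c • u).val t = c • u.val t := by
  rw [val_smul]
  exact OrliczSpace.coe_smul _ _

theorem ae_dot_smul (c : ℝ) (u : OrliczSobolev G I) :
    ∀ᵐ t ∂I.measure, (c • u).dot t = c • u.dot t := by
  rw [dot_smul]
  exact OrliczSpace.coe_smul _ _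

/-- `W^1 L^G` embeds continuously into `L^∞`. -/
theorem exists_ae_norm_le (G : GFunction N) (I : FiniteInterval) :
    ∃ C : ℝ, 0 ≤ C ∧ ∀ u : OrliczSobolev G I, ∀ᵐ t ∂I.measure, ‖u.val t‖ ≤ C * ‖u‖ := by
  obtain ⟨C, hC, h⟩ := OrliczSpace.exists_ae_norm_le_of_hasWeakDeriv G I
  obtain ⟨D, hD, h'⟩ := OrliczSpace.exists_integral_norm_le G I
  refine ⟨C * D, by positivity, fun u => ?_⟩
  filter_upwards [h u.val u.dot u.hasWeakDeriv_dot] with t ht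
  refine ht.trans ?_
  rw [norm_def, mul_assoc, mul_add D]
  exact mul_le_mul_of_nonneg_left (add_le_add (h' _) (h' _)) hC

/-- The functional `φ ↦ ∫ ⟨P, φ⟩ + ∫ ⟨Q, φ'⟩`. -/
noncomputable def pairing (P Q : ℝ → Vec N) (φ : OrliczSobolev G I) : ℝ :=
  (∫ t, inner ℝ (P t) (φ.val t) ∂I.measure) + ∫ t, inner ℝ (Q t) (φ.dot t) ∂I.measure

theorem integrable_inner_val {P : ℝ → Vec N} (hP : Integrable P I.measure)
    (φ : OrliczSobolev G I) : Integrable (fun t => inner ℝ (P t) (φ.val t)) I.measure := by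
  obtain ⟨C, -, h⟩ := exists_ae_norm_le G I
  refine (hP.norm.mul_const (C * ‖φ‖)).mono' (hP.1.inner φ.val.aesm) ?_
  filter_upwards [h φ] with t ht
  exact (norm_inner_le_norm (𝕜 := ℝ) _ _).trans (mul_le_mul_of_nonneg_left ht (norm_nonneg _))

theorem exists_abs_pairing_le (G : GFunction N) (I : FiniteInterval) :
    ∃ C : ℝ, 0 ≤ C ∧ ∀ (P Q : ℝ → Vec N) (k : ℝ), Integrable P I.measure →
      AEStronglyMeasurable Q I.measure → 0 < k →
      Integrable (fun t => G.conj (k • Q t)) I.measure → ∀ φ : OrliczSobolev G I,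
      |pairing P Q φ| ≤ (C * ∫ t, ‖P t‖ ∂I.measure +
        k⁻¹ * (∫ t, G.conj (k • Q t) ∂I.measure + 1)) * ‖φ‖ := by
  obtain ⟨C, hC, h⟩ := exists_ae_norm_le G I
  refine ⟨C, hC, fun P Q k hP hQ hk hint φ => ?_⟩
  refine (abs_add_le _ _).trans ?_
  rw [add_mul]
  refine add_le_add ?_ ((OrliczSpace.abs_integral_inner_le hQ hk hint φ.dot).trans ?_)
  · refine abs_integral_le_integral_abs.trans ?_
    rw [mul_right_comm, ← integral_const_mul]
    refine integral_mono_ae (integrable_inner_val hP φ).abs (hP.norm.const_mul _) ?_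
    filter_upwards [h φ] with t ht
    rw [mul_comm]
    exact (norm_inner_le_norm (𝕜 := ℝ) _ _).trans (mul_le_mul_of_nonneg_left ht (norm_nonneg _))
  · have h0 : 0 ≤ ∫ t, G.conj (k • Q t) ∂I.measure := integral_nonneg fun t => G.conj_nonneg _
    exact mul_le_mul_of_nonneg_left φ.luxemburg_dot_le (by positivity)

/-- The functional `φ ↦ ∫ ⟨P, φ⟩ + ∫ ⟨Q, φ'⟩` as a continuous linear map. -/
noncomputable def pairingCLM (P Q : ℝ → Vec N) (hP : Integrable P I.measure)
    (hQ : AEStronglyMeasurable Q I.measure)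
    (hint : Integrable (fun t => G.conj (Q t)) I.measure) : OrliczSobolev G I →L[ℝ] ℝ :=
  LinearMap.mkContinuousOfExistsBound
    { toFun := pairing P Q
      map_add' := fun u v => by
        have h1 : ∫ t, inner ℝ (P t) ((u + v).val t) ∂I.measure =
            ∫ t, inner ℝ (P t) (u.val t) ∂I.measure + ∫ t, inner ℝ (P t) (v.val t) ∂I.measure := by
          rw [← integral_add (integrable_inner_val hP u) (integrable_inner_val hP v)]
          refine integral_congr_ae ?_
          filter_upwards [ae_val_add u v] with t ht
          rw [ht, inner_add_right]
        have h2 : ∫ t, inner ℝ (Q t) ((u + v).dot t) ∂I.measure =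
            ∫ t, inner ℝ (Q t) (u.dot t) ∂I.measure + ∫ t, inner ℝ (Q t) (v.dot t) ∂I.measure := by
          rw [← integral_add (OrliczSpace.integrable_inner hQ hint _)
            (OrliczSpace.integrable_inner hQ hint _)]
          refine integral_congr_ae ?_
          filter_upwards [ae_dot_add u v] with t ht
          rw [ht, inner_add_right]
        unfold pairing
        rw [h1, h2]
        ring
      map_smul' := fun c u => by
        have h1 : ∫ t, inner ℝ (P t) ((c • u).val t) ∂I.measure =
            c * ∫ t, inner ℝ (P t) (u.val t) ∂I.measure := by
          rw [← integral_const_mul]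
          refine integral_congr_ae ?_
          filter_upwards [ae_val_smul c u] with t ht
          rw [ht, real_inner_smul_right]
        have h2 : ∫ t, inner ℝ (Q t) ((c • u).dot t) ∂I.measure =
            c * ∫ t, inner ℝ (Q t) (u.dot t) ∂I.measure := by
          rw [← integral_const_mul]
          refine integral_congr_ae ?_
          filter_upwards [ae_dot_smul c u] with t ht
          rw [ht, real_inner_smul_right]
        unfold pairing
        rw [h1, h2, RingHom.id_apply, smul_eq_mul, mul_add] } (by
    obtain ⟨C, -, h⟩ := exists_abs_pairing_le G I
    exact ⟨_, h P Q 1 hP hQ one_pos (by simpa using hint)⟩)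

/-- A rapidly converging sequence in `W^1 L^G` converges a.e. together with its derivatives, and
is dominated. -/
theorem exists_dominated {u : OrliczSobolev G I} {v : ℕ → OrliczSobolev G I}
    (h : ∀ n, ‖v n - u‖ < (1 / 2) ^ (n + 1)) :
    ∃ R : ℝ, ∃ g : ℝ → ℝ, Integrable g I.measure ∧ ∀ᵐ t ∂I.measure,
      (‖u.val t‖ ≤ R ∧ G (u.dot t) ≤ g t) ∧ (∀ n, ‖(v n).val t‖ ≤ R ∧ G ((v n).dot t) ≤ g t) ∧
      Tendsto (fun n => (v n).val t) atTop (𝓝 (u.val t)) ∧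
      Tendsto (fun n => (v n).dot t) atTop (𝓝 (u.dot t)) := by
  obtain ⟨C, hC, hCb⟩ := exists_ae_norm_le G I
  obtain ⟨D, hD, hDb⟩ := OrliczSpace.exists_integral_norm_le G I
  -- `G((v n)')` is at most `G(2u') + G(2(d n)')` by convexity. The modulars of `2(d n)'` are at
  -- most `2^{-n}`, so the sum `S` of the second terms over all `n` is integrable and dominates each
  -- of them.
  let d : ℕ → OrliczSobolev G I := fun n => v n - u
  have hgeom : ∑' n : ℕ, ENNReal.ofReal ((1 / 2) ^ n) ≠ ⊤ := by
    rw [← ENNReal.ofReal_tsum_of_nonneg (fun n => by positivity) summable_geometric_two]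
    exact ENNReal.ofReal_ne_top
  have hpow : ∀ n : ℕ, ((1 : ℝ) / 2) ^ (n + 1) = (1 / 2) ^ n / 2 := fun n => by
    rw [pow_succ]
    ring
  let S : ℝ → ENNReal := fun t => ∑' n, ENNReal.ofReal (G ((2 : ℝ) • (d n).dot t))
  have hSm : ∀ n, AEMeasurable (fun t => ENNReal.ofReal (G ((2 : ℝ) • (d n).dot t))) I.measure :=
    fun n => G.aemeasurable_comp I ((d n).dot.aesm.const_smul (2 : ℝ))
  have hS : ∫⁻ t, S t ∂I.measure ≠ ⊤ := by
    rw [lintegral_tsum hSm]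
    refine ne_top_of_le_ne_top hgeom (ENNReal.tsum_le_tsum fun n => ?_)
    refine OrliczSpace.modular_smul_le_of_luxemburg_lt two_pos
      (pow_le_one₀ (by norm_num) (by norm_num)) ?_
    have := (d n).luxemburg_dot_le.trans_lt (h n)
    rw [hpow] at this
    linarith
  -- Summability of the `L^1` norms makes `∑ |(d n)'|` finite a.e., hence `(d n)' → 0` a.e.
  have hT : ∫⁻ t, ∑' n, ‖(d n).dot t‖ₑ ∂I.measure ≠ ⊤ := by
    rw [lintegral_tsum fun n => (d n).dot.aesm.enorm]
    refine ne_top_of_le_ne_top (b := ∑' n : ℕ, ENNReal.ofReal D * ENNReal.ofReal ((1 / 2) ^ n)) ?_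
      (ENNReal.tsum_le_tsum fun n => ?_)
    · rw [ENNReal.tsum_mul_left]
      exact ENNReal.mul_ne_top ENNReal.ofReal_ne_top hgeom
    · rw [← ofReal_integral_norm_eq_lintegral_enorm (d n).dot.integrable, ← ENNReal.ofReal_mul hD]
      refine ENNReal.ofReal_le_ofReal ((hDb _).trans (mul_le_mul_of_nonneg_left ?_ hD))
      have := (d n).luxemburg_dot_le.trans_lt (h n)
      rw [hpow] at this
      have : (0 : ℝ) ≤ (1 / 2) ^ n := by positivity
      linarith
  have hadd : ∀ᵐ t ∂I.measure, ∀ n, (v n).val t = u.val t + (d n).val t ∧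
      (v n).dot t = u.dot t + (d n).dot t := by
    refine ae_all_iff.2 fun n => ?_
    have h1 := ae_val_add u (d n)
    have h2 := ae_dot_add u (d n)
    rw [show u + d n = v n from add_sub_cancel u (v n)] at h1 h2
    exact h1.and h2
  have hdval : ∀ᵐ t ∂I.measure, ∀ n, ‖(d n).val t‖ ≤ C * (1 / 2) ^ n := by
    refine ae_all_iff.2 fun n => ?_
    filter_upwards [hCb (d n)] with t ht
    refine ht.trans (mul_le_mul_of_nonneg_left ?_ hC)
    have := h n
    rw [hpow] at this
    have : (0 : ℝ) ≤ (1 / 2) ^ n := by positivity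
    change ‖v n - u‖ ≤ _
    linarith
  refine ⟨C * ‖u‖ + C, fun t => G ((2 : ℝ) • u.dot t) + (S t).toReal,
    (u.dot.integrable_comp_smul 2).add
      (integrable_toReal_of_lintegral_ne_top (AEMeasurable.tsum hSm) hS), ?_⟩
  filter_upwards [hCb u, hadd, hdval, ae_lt_top' (AEMeasurable.tsum hSm) hS,
    ae_lt_top' (AEMeasurable.tsum fun n => (d n).dot.aesm.enorm) hT] with t h1 h2 h3 h4 h5
  refine ⟨⟨by linarith, ?_⟩, fun n => ⟨?_, ?_⟩, ?_, ?_⟩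
  · have := G.le_smul_of_one_le one_le_two (u.dot t)
    have := G.nonneg (u.dot t)
    have : 0 ≤ (S t).toReal := ENNReal.toReal_nonneg
    linarith
  · rw [(h2 n).1]
    have h6 : C * (1 / 2) ^ n ≤ C :=
      mul_le_of_le_one_right hC (pow_le_one₀ (by norm_num) (by norm_num))
    exact (norm_add_le _ _).trans (add_le_add h1 ((h3 n).trans h6))
  · rw [(h2 n).2]
    refine (G.add_le _ _).trans (add_le_add_right ?_ _)
    rw [← ENNReal.ofReal_le_iff_le_toReal h4.ne]
    exact ENNReal.le_tsum (f := fun n => ENNReal.ofReal (G ((2 : ℝ) • (d n).dot t))) n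
  · simp only [fun n => (h2 n).1]
    have h6 : Tendsto (fun n : ℕ => C * (1 / 2 : ℝ) ^ n) atTop (𝓝 0) := by
      simpa using (tendsto_pow_atTop_nhds_zero_of_lt_one (r := (1 / 2 : ℝ)) (by norm_num)
        (by norm_num)).const_mul C
    simpa using (squeeze_zero_norm h3 h6).const_add (u.val t)
  · simp only [fun n => (h2 n).2]
    have h6 := ENNReal.tendsto_atTop_zero_of_tsum_ne_top h5.ne
    have h7 : Tendsto (fun n => (d n).dot t) atTop (𝓝 0) := by
      rwa [tendsto_zero_iff_enorm_tendsto_zero]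
    simpa using h7.const_add (u.dot t)

end OrliczSobolev

/-! ### From Gateaux to Fréchet differentiability -/

theorem GFunction.smul_le_self {N : ℕ} (G : GFunction N) {s : ℝ} (hs : |s| ≤ 1) (x : Vec N) :
    G (s • x) ≤ G x := by
  have h := (G.smul_le (abs_nonneg s) hs x).trans (mul_le_of_le_one_left (G.nonneg x) hs)
  rcases abs_cases s with ⟨h1, -⟩ | ⟨h1, -⟩
  · rwa [h1] at h
  · rwa [h1, neg_smul, G.even] at h

/-- A function with a continuous Gateaux derivative is of class `C^1`. -/
theorem hasFDerivAt_of_hasLineDerivAt {E : Type*} [NormedAddCommGroup E] [NormedSpace ℝ E]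
    {f : E → ℝ} {f' : E → E →L[ℝ] ℝ} (hf' : Continuous f')
    (h : ∀ u v, HasLineDerivAt ℝ f (f' u v) u v) (u : E) : HasFDerivAt f (f' u) u := by
  rw [hasFDerivAt_iff_isLittleO_nhds_zero, Asymptotics.isLittleO_iff]
  intro ε hε
  obtain ⟨δ, hδ, hball⟩ := Metric.continuousAt_iff.1 hf'.continuousAt ε hε
  filter_upwards [Metric.ball_mem_nhds (0 : E) hδ] with v hv
  rw [mem_ball_zero_iff] at hv
  -- Subtracting the linear part leaves a function of `s` whose derivative is `(f'(u + s v) - f'(u))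
  -- v`, of size at most `ε ‖v‖`; the mean value inequality on `[0, 1]` concludes.
  have hd : ∀ s : ℝ, HasDerivAt (fun s : ℝ => f (u + s • v) - s * f' u v)
      (f' (u + s • v) v - f' u v) s := by
    intro s
    have h1 : HasDerivAt (fun r : ℝ => f (u + s • v + r • v)) (f' (u + s • v) v) (s - s) := by
      rw [sub_self]
      exact h (u + s • v) v
    have h2 := h1.comp_sub_const s s
    have h3 : (fun r : ℝ => f (u + s • v + (r - s) • v)) = fun r => f (u + r • v) := by
      funext r
      rw [add_assoc, ← add_smul, add_sub_cancel]
    rw [h3] at h2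
    simpa using h2.fun_sub ((hasDerivAt_id s).mul_const (f' u v))
  have key := norm_image_sub_le_of_norm_deriv_le_segment_01' (C := ε * ‖v‖)
    (fun s _ => (hd s).hasDerivWithinAt) (fun s hs => ?_)
  · have h4 : f (u + v) - f u - f' u v =
        f (u + (1 : ℝ) • v) - 1 * f' u v - (f (u + (0 : ℝ) • v) - 0 * f' u v) := by
      simp only [one_smul, zero_smul, add_zero, one_mul, zero_mul, sub_zero]
      ring
    rw [h4]
    exact key
  · rw [← sub_apply]
    refine (ContinuousLinearMap.le_opNorm _ _).trans
      (mul_le_mul_of_nonneg_right ?_ (norm_nonneg v))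
    rw [← dist_eq_norm]
    refine (hball ?_).le
    rw [dist_eq_norm, add_sub_cancel_left, norm_smul, Real.norm_of_nonneg hs.1]
    exact (mul_le_of_le_one_left (norm_nonneg v) hs.2.le).trans_lt hv

/-! ### Partial gradients: joint continuity, chain rule, measurability -/

section Regularity

variable {N : ℕ} {I : FiniteInterval} {F : ℝ → Vec N → Vec N → ℝ}

theorem FiniteInterval.isOpen_Ioo_prod_univ (I : FiniteInterval) :
    IsOpen (Ioo I.left I.right ×ˢ (univ : Set (Vec N × Vec N))) :=
  isOpen_Ioo.prod isOpen_univ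

theorem hasFDerivAt_lagrangian
    (hF : ContDiffOn ℝ 1 (fun p : ℝ × Vec N × Vec N => F p.1 p.2.1 p.2.2)
      (Ioo I.left I.right ×ˢ (univ : Set (Vec N × Vec N))))
    {t : ℝ} (ht : t ∈ Ioo I.left I.right) (x v : Vec N) :
    HasFDerivAt (fun p : ℝ × Vec N × Vec N => F p.1 p.2.1 p.2.2)
      (fderiv ℝ (fun p : ℝ × Vec N × Vec N => F p.1 p.2.1 p.2.2) (t, x, v)) (t, x, v) :=
  ((hF.differentiableOn one_ne_zero).differentiableAt
    (I.isOpen_Ioo_prod_univ.mem_nhds ⟨ht, mem_univ _⟩)).hasFDerivAt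

/-- The partial gradient is the joint derivative restricted to one factor, so it inherits joint
continuity in `(t, x, v)`. -/
theorem gradX_eq
    (hF : ContDiffOn ℝ 1 (fun p : ℝ × Vec N × Vec N => F p.1 p.2.1 p.2.2)
      (Ioo I.left I.right ×ˢ (univ : Set (Vec N × Vec N))))
    {t : ℝ} (ht : t ∈ Ioo I.left I.right) (x v : Vec N) :
    gradX F t x v = (InnerProductSpace.toDual ℝ (Vec N)).symm
      ((fderiv ℝ (fun p : ℝ × Vec N × Vec N => F p.1 p.2.1 p.2.2) (t, x, v)).comp
        ((ContinuousLinearMap.inr ℝ ℝ (Vec N × Vec N)).comp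
          (ContinuousLinearMap.inl ℝ (Vec N) (Vec N)))) := by
  have h1 : HasFDerivAt (fun y : Vec N => ((t, y, v) : ℝ × Vec N × Vec N))
      ((ContinuousLinearMap.inr ℝ ℝ (Vec N × Vec N)).comp
        (ContinuousLinearMap.inl ℝ (Vec N) (Vec N))) x :=
    (hasFDerivAt_prodMk_right t (x, v)).comp x (hasFDerivAt_prodMk_left x v)
  have h2 := (hasFDerivAt_lagrangian hF ht x v).comp x h1
  exact h2.hasGradientAt.gradient

theorem gradV_eq
    (hF : ContDiffOn ℝ 1 (fun p : ℝ × Vec N × Vec N => F p.1 p.2.1 p.2.2)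
      (Ioo I.left I.right ×ˢ (univ : Set (Vec N × Vec N))))
    {t : ℝ} (ht : t ∈ Ioo I.left I.right) (x v : Vec N) :
    gradV F t x v = (InnerProductSpace.toDual ℝ (Vec N)).symm
      ((fderiv ℝ (fun p : ℝ × Vec N × Vec N => F p.1 p.2.1 p.2.2) (t, x, v)).comp
        ((ContinuousLinearMap.inr ℝ ℝ (Vec N × Vec N)).comp
          (ContinuousLinearMap.inr ℝ (Vec N) (Vec N)))) := by
  have h1 : HasFDerivAt (fun y : Vec N => ((t, x, y) : ℝ × Vec N × Vec N))
      ((ContinuousLinearMap.inr ℝ ℝ (Vec N × Vec N)).comp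
        (ContinuousLinearMap.inr ℝ (Vec N) (Vec N))) v :=
    (hasFDerivAt_prodMk_right t (x, v)).comp v (hasFDerivAt_prodMk_right x v)
  have h2 := (hasFDerivAt_lagrangian hF ht x v).comp v h1
  exact h2.hasGradientAt.gradient

theorem continuousOn_gradX
    (hF : ContDiffOn ℝ 1 (fun p : ℝ × Vec N × Vec N => F p.1 p.2.1 p.2.2)
      (Ioo I.left I.right ×ˢ (univ : Set (Vec N × Vec N)))) :
    ContinuousOn (fun p : ℝ × Vec N × Vec N => gradX F p.1 p.2.1 p.2.2)
      (Ioo I.left I.right ×ˢ (univ : Set (Vec N × Vec N))) := by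
  have h := hF.continuousOn_fderiv_of_isOpen I.isOpen_Ioo_prod_univ le_rfl
  refine ((InnerProductSpace.toDual ℝ (Vec N)).symm.continuous.comp_continuousOn
    (h.clm_comp (continuousOn_const (c := (ContinuousLinearMap.inr ℝ ℝ (Vec N × Vec N)).comp
      (ContinuousLinearMap.inl ℝ (Vec N) (Vec N)))))).congr fun p hp => ?_
  exact gradX_eq hF hp.1 p.2.1 p.2.2

theorem continuousOn_gradV
    (hF : ContDiffOn ℝ 1 (fun p : ℝ × Vec N × Vec N => F p.1 p.2.1 p.2.2)
      (Ioo I.left I.right ×ˢ (univ : Set (Vec N × Vec N)))) :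
    ContinuousOn (fun p : ℝ × Vec N × Vec N => gradV F p.1 p.2.1 p.2.2)
      (Ioo I.left I.right ×ˢ (univ : Set (Vec N × Vec N))) := by
  have h := hF.continuousOn_fderiv_of_isOpen I.isOpen_Ioo_prod_univ le_rfl
  refine ((InnerProductSpace.toDual ℝ (Vec N)).symm.continuous.comp_continuousOn
    (h.clm_comp (continuousOn_const (c := (ContinuousLinearMap.inr ℝ ℝ (Vec N × Vec N)).comp
      (ContinuousLinearMap.inr ℝ (Vec N) (Vec N)))))).congr fun p hp => ?_
  exact gradV_eq hF hp.1 p.2.1 p.2.2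

theorem hasDerivAt_lagrangian_line
    (hF : ContDiffOn ℝ 1 (fun p : ℝ × Vec N × Vec N => F p.1 p.2.1 p.2.2)
      (Ioo I.left I.right ×ˢ (univ : Set (Vec N × Vec N))))
    {t : ℝ} (ht : t ∈ Ioo I.left I.right) (x v h k : Vec N) (s : ℝ) :
    HasDerivAt (fun s : ℝ => F t (x + s • h) (v + s • k))
      (inner ℝ (gradX F t (x + s • h) (v + s • k)) h +
        inner ℝ (gradV F t (x + s • h) (v + s • k)) k) s := by
  have h1 : HasDerivAt (fun s : ℝ => ((t, x + s • h, v + s • k) : ℝ × Vec N × Vec N))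
      (0, h, k) s := by
    have hx : HasDerivAt (fun s : ℝ => x + s • h) h s := by
      simpa using ((hasDerivAt_id s).smul_const h).const_add x
    have hv : HasDerivAt (fun s : ℝ => v + s • k) k s := by
      simpa using ((hasDerivAt_id s).smul_const k).const_add v
    exact (hasDerivAt_const s t).prodMk (hx.prodMk hv)
  have h2 := (hasFDerivAt_lagrangian hF ht (x + s • h) (v + s • k)).comp_hasDerivAt s h1
  refine h2.congr_deriv ?_
  rw [gradX_eq hF ht, gradV_eq hF ht, InnerProductSpace.toDual_symm_apply,
    InnerProductSpace.toDual_symm_apply]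
  simp [← map_add]

theorem aestronglyMeasurable_comp_prod {E : Type*} [NormedAddCommGroup E]
    {W : ℝ × Vec N × Vec N → E}
    (hW : ContinuousOn W (Ioo I.left I.right ×ˢ (univ : Set (Vec N × Vec N))))
    {x v : ℝ → Vec N} (hx : AEStronglyMeasurable x I.measure)
    (hv : AEStronglyMeasurable v I.measure) :
    AEStronglyMeasurable (fun t => W (t, x t, v t)) I.measure := by
  have hS : MeasurableSet (Ioo I.left I.right ×ˢ (univ : Set (Vec N × Vec N))) :=
    I.isOpen_Ioo_prod_univ.measurableSet
  have h1 : AEMeasurable (fun t => (t, x t, v t)) I.measure :=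
    aemeasurable_id.prodMk (hx.aemeasurable.prodMk hv.aemeasurable)
  -- `W` is only known to be continuous over the open interval, and the image of the measure under
  -- `t ↦ (t, x t, v t)` is concentrated there.
  have h2 : ∀ᵐ p ∂(I.measure.map fun t => (t, x t, v t)), p ∈ Ioo I.left I.right ×ˢ univ := by
    refine (ae_map_iff h1 hS).2 ?_
    filter_upwards [I.ae_mem_Ioo] with t ht
    exact ⟨ht, mem_univ _⟩
  have h3 := hW.aestronglyMeasurable (μ := I.measure.map fun t => (t, x t, v t)) hS
  rw [Measure.restrict_eq_self_of_ae_mem h2] at h3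
  exact h3.comp_aemeasurable h1

end Regularity

/-! ### Growth, Gateaux derivative and its continuity -/

/-- The regularity and growth conditions on the Lagrangian `F`. -/
structure IsAdmissibleLagrangian {N : ℕ} (G : GFunction N) (I : FiniteInterval)
    (F : ℝ → Vec N → Vec N → ℝ) (a : ℝ≥0 → ℝ≥0) (b c : ℝ → ℝ) : Prop where
  differentiable : Differentiable ℝ (G : Vec N → ℝ)
  continuous : Continuous a
  integrable_left : Integrable b I.measure
  nonneg_left : ∀ᵐ t ∂I.measure, 0 ≤ b t
  integrable_right : Integrable c I.measure
  nonneg_right : ∀ᵐ t ∂I.measure, 0 ≤ c t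
  contDiffOn : ContDiffOn ℝ 1 (fun p : ℝ × Vec N × Vec N => F p.1 p.2.1 p.2.2)
    (Ioo I.left I.right ×ˢ (univ : Set (Vec N × Vec N)))
  abs_le : ∀ᵐ t ∂I.measure, ∀ x v, |F t x v| ≤ a ‖x‖₊ * (b t + G v)
  norm_gradX_le : ∀ᵐ t ∂I.measure, ∀ x v, ‖gradX F t x v‖ ≤ a ‖x‖₊ * (b t + G v)
  conj_gradV_le : ∀ᵐ t ∂I.measure, ∀ x v,
    G.conj (gradV F t x v) ≤ a ‖x‖₊ * (c t + G.conj (gradient (G : Vec N → ℝ) v))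

namespace IsAdmissibleLagrangian

open OrliczSobolev

variable {N : ℕ} {G : GFunction N} {I : FiniteInterval} {F : ℝ → Vec N → Vec N → ℝ}
  {a : ℝ≥0 → ℝ≥0} {b c : ℝ → ℝ} (H : IsAdmissibleLagrangian G I F a b c)

include H

/-- On bounded sets of `x`, the Lagrangian and its gradients have growth at most `m t + A * G v`
in the respective sense. -/
theorem exists_growth (R : ℝ) {k : ℝ} (hk : 0 ≤ k) :
    ∃ A : ℝ, ∃ m : ℝ → ℝ, 0 ≤ A ∧ Integrable m I.measure ∧ ∀ᵐ t ∂I.measure, ∀ x v, ‖x‖ ≤ R →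
      |F t x v| ≤ m t + A * G v ∧ ‖gradX F t x v‖ ≤ m t + A * G v ∧
      G.conj (k • gradV F t x v) ≤ m t + A * G v := by
  obtain ⟨B, hB⟩ := (isCompact_Icc (a := (0 : ℝ≥0)) (b := R.toNNReal)).bddAbove_image
    H.continuous.continuousOn
  have haB : ∀ x : Vec N, ‖x‖ ≤ R → (a ‖x‖₊ : ℝ) ≤ B := fun x hx =>
    NNReal.coe_le_coe.2 (hB ⟨‖x‖₊, ⟨zero_le, by
      rw [← NNReal.coe_le_coe, coe_nnnorm]
      exact hx.trans (Real.le_coe_toNNReal R)⟩, rfl⟩)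
  have hB0 : (0 : ℝ) ≤ B := B.2
  obtain ⟨C, K, hC, hK, h1⟩ := G.exists_conj_smul_le hk
  obtain ⟨D, E, hD, hE, h2⟩ := G.exists_smul_le 2
  -- Here `B` bounds `a` on `[0, R]`. The terms with `K` come from the chain `G*(k F_v) ≤ C + K
  -- G*(F_v) ≤ C + K B (c + G*(∇G v))` and `G*(∇G v) ≤ G(2v) ≤ D + E G(v)`.
  refine ⟨B + K * B * E, fun t => B * b t + C + K * B * c t + K * B * D, by positivity,
    ((((H.integrable_left.const_mul _).add (integrable_const _)).add
      (H.integrable_right.const_mul _)).add (integrable_const _)), ?_⟩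
  filter_upwards [H.nonneg_left, H.nonneg_right, H.abs_le, H.norm_gradX_le, H.conj_gradV_le]
    with t hb hc h3 h4 h5 x v hx
  have hG := G.nonneg v
  have hKB : 0 ≤ K * B := by positivity
  have e1 : 0 ≤ K * B * E * G v := by positivity
  have e2 : 0 ≤ K * B * c t := by positivity
  have e3 : 0 ≤ K * B * D := by positivity
  have e4 : 0 ≤ B * b t := by positivity
  have e5 : 0 ≤ B * G v := by positivity
  have h6 : (a ‖x‖₊ : ℝ) * (b t + G v) ≤ B * (b t + G v) :=
    mul_le_mul_of_nonneg_right (haB x hx) (by positivity)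
  refine ⟨by linarith [h3 x v], by linarith [h4 x v], ?_⟩
  have h7 : G.conj (gradV F t x v) ≤ B * (c t + (D + E * G v)) := by
    have e6 := G.conj_nonneg (gradient (G : Vec N → ℝ) v)
    refine (h5 x v).trans (mul_le_mul (haB x hx) ?_ (by positivity) hB0)
    linarith [G.conj_gradient_le H.differentiable v, h2 v]
  have h8 := mul_le_mul_of_nonneg_left h7 hK
  have h9 := h1 (gradV F t x v)
  nlinarith

theorem aestronglyMeasurable_comp {x v : ℝ → Vec N} (hx : AEStronglyMeasurable x I.measure)
    (hv : AEStronglyMeasurable v I.measure) :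
    AEStronglyMeasurable (fun t => F t (x t) (v t)) I.measure :=
  aestronglyMeasurable_comp_prod H.contDiffOn.continuousOn hx hv

theorem aestronglyMeasurable_gradX {x v : ℝ → Vec N} (hx : AEStronglyMeasurable x I.measure)
    (hv : AEStronglyMeasurable v I.measure) :
    AEStronglyMeasurable (fun t => gradX F t (x t) (v t)) I.measure :=
  aestronglyMeasurable_comp_prod (continuousOn_gradX H.contDiffOn) hx hv

theorem aestronglyMeasurable_gradV {x v : ℝ → Vec N} (hx : AEStronglyMeasurable x I.measure)
    (hv : AEStronglyMeasurable v I.measure) :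
    AEStronglyMeasurable (fun t => gradV F t (x t) (v t)) I.measure :=
  aestronglyMeasurable_comp_prod (continuousOn_gradV H.contDiffOn) hx hv

theorem integrable_all (u : OrliczSobolev G I) :
    Integrable (fun t => F t (u.val t) (u.dot t)) I.measure ∧
    Integrable (fun t => gradX F t (u.val t) (u.dot t)) I.measure ∧
    Integrable (fun t => G.conj (gradV F t (u.val t) (u.dot t))) I.measure := by
  obtain ⟨C, -, hC⟩ := exists_ae_norm_le G I
  obtain ⟨A, m, hA, hm, h⟩ := H.exists_growth (C * ‖u‖) zero_le_one
  have hi : Integrable (fun t => m t + A * G (u.dot t)) I.measure :=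
    hm.add (u.dot.integrable_comp.const_mul A)
  refine ⟨hi.mono' (H.aestronglyMeasurable_comp u.val.aesm u.dot.aesm) ?_,
    hi.mono' (H.aestronglyMeasurable_gradX u.val.aesm u.dot.aesm) ?_,
    hi.mono' (G.continuous_conj.comp_aestronglyMeasurable
      (H.aestronglyMeasurable_gradV u.val.aesm u.dot.aesm)) ?_⟩
  · filter_upwards [h, hC u] with t ht hu
    exact (ht _ _ hu).1
  · filter_upwards [h, hC u] with t ht hu
    exact (ht _ _ hu).2.1
  · filter_upwards [h, hC u] with t ht hu
    rw [Real.norm_of_nonneg (G.conj_nonneg _)]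
    simpa using (ht _ _ hu).2.2

/-- The derivative of the Lagrangian functional. -/
noncomputable def derivative (u : OrliczSobolev G I) : OrliczSobolev G I →L[ℝ] ℝ :=
  pairingCLM (fun t => gradX F t (u.val t) (u.dot t)) (fun t => gradV F t (u.val t) (u.dot t))
    (H.integrable_all u).2.1 (H.aestronglyMeasurable_gradV u.val.aesm u.dot.aesm)
    (H.integrable_all u).2.2

theorem derivative_apply (u φ : OrliczSobolev G I) :
    H.derivative u φ = (∫ t, inner ℝ (gradX F t (u.val t) (u.dot t)) (φ.val t) ∂I.measure) +
      ∫ t, inner ℝ (gradV F t (u.val t) (u.dot t)) (φ.dot t) ∂I.measure := rfl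

theorem derivative_sub_apply (u v φ : OrliczSobolev G I) :
    (H.derivative v - H.derivative u) φ =
      pairing (fun t => gradX F t (v.val t) (v.dot t) - gradX F t (u.val t) (u.dot t))
        (fun t => gradV F t (v.val t) (v.dot t) - gradV F t (u.val t) (u.dot t)) φ := by
  have hv : ∀ v : OrliczSobolev G I,
      Integrable (fun t => inner ℝ (gradV F t (v.val t) (v.dot t)) (φ.dot t)) I.measure := fun v =>
    OrliczSpace.integrable_inner (H.aestronglyMeasurable_gradV v.val.aesm v.dot.aesm)
      (H.integrable_all v).2.2 φ.dot
  rw [sub_apply, derivative_apply, derivative_apply]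
  simp only [pairing, inner_sub_left]
  rw [integral_sub (integrable_inner_val (H.integrable_all v).2.1 φ)
    (integrable_inner_val (H.integrable_all u).2.1 φ), integral_sub (hv v) (hv u)]
  ring

theorem tendsto_derivative_of_fast {u : OrliczSobolev G I} {v : ℕ → OrliczSobolev G I}
    (h : ∀ n, ‖v n - u‖ < (1 / 2) ^ (n + 1)) :
    Tendsto (fun n => H.derivative (v n)) atTop (𝓝 (H.derivative u)) := by
  obtain ⟨R, g, hg, hdom⟩ := exists_dominated h
  obtain ⟨C, hC, hpair⟩ := exists_abs_pairing_le G I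
  let P : ℕ → ℝ → Vec N := fun n t =>
    gradX F t ((v n).val t) ((v n).dot t) - gradX F t (u.val t) (u.dot t)
  let Q : ℕ → ℝ → Vec N := fun n t =>
    gradV F t ((v n).val t) ((v n).dot t) - gradV F t (u.val t) (u.dot t)
  have hQm : ∀ n, AEStronglyMeasurable (Q n) I.measure := fun n =>
    (H.aestronglyMeasurable_gradV (v n).val.aesm (v n).dot.aesm).sub
      (H.aestronglyMeasurable_gradV u.val.aesm u.dot.aesm)
  have hPi : ∀ n, Integrable (P n) I.measure := fun n =>
    (H.integrable_all (v n)).2.1.sub (H.integrable_all u).2.1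
  have hlim : ∀ᵐ t ∂I.measure, Tendsto (fun n => P n t) atTop (𝓝 0) ∧
      Tendsto (fun n => Q n t) atTop (𝓝 0) := by
    filter_upwards [hdom, I.ae_mem_Ioo] with t ht htI
    have h1 : Tendsto (fun n => (t, (v n).val t, (v n).dot t)) atTop
        (𝓝 (t, u.val t, u.dot t)) :=
      tendsto_const_nhds.prodMk_nhds (ht.2.2.1.prodMk_nhds ht.2.2.2)
    have h2 : Ioo I.left I.right ×ˢ (univ : Set (Vec N × Vec N)) ∈ 𝓝 (t, u.val t, u.dot t) :=
      I.isOpen_Ioo_prod_univ.mem_nhds ⟨htI, mem_univ _⟩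
    have hX := (((continuousOn_gradX H.contDiffOn).continuousAt h2).tendsto.comp h1).sub_const
      (gradX F t (u.val t) (u.dot t))
    have hV := (((continuousOn_gradV H.contDiffOn).continuousAt h2).tendsto.comp h1).sub_const
      (gradV F t (u.val t) (u.dot t))
    simp only [sub_self] at hX hV
    exact ⟨hX, hV⟩
  have hP0 : Tendsto (fun n => ∫ t, ‖P n t‖ ∂I.measure) atTop (𝓝 0) := by
    obtain ⟨A, m, hA, hm, hgr⟩ := H.exists_growth R zero_le_one
    have key := tendsto_integral_of_dominated_convergence (μ := I.measure)
      (F := fun n t => ‖P n t‖) (f := fun _ => (0 : ℝ)) (fun t => 2 * (m t + A * g t))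
      (fun n => (hPi n).1.norm) ((hm.add (hg.const_mul A)).const_mul 2) (fun n => ?_) ?_
    · simpa using key
    · filter_upwards [hdom, hgr] with t ht h1
      rw [norm_norm]
      have e1 := (h1 _ ((v n).dot t) (ht.2.1 n).1).2.1
      have e2 := (h1 _ (u.dot t) ht.1.1).2.1
      have e3 := mul_le_mul_of_nonneg_left (ht.2.1 n).2 hA
      have e4 := mul_le_mul_of_nonneg_left ht.1.2 hA
      refine (norm_sub_le _ _).trans ?_
      linarith
    · filter_upwards [hlim] with t ht
      simpa using ht.1.norm
  have hQ : ∀ k : ℝ, 0 ≤ k → (∀ n, Integrable (fun t => G.conj (k • Q n t)) I.measure) ∧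
      Tendsto (fun n => ∫ t, G.conj (k • Q n t) ∂I.measure) atTop (𝓝 0) := by
    intro k hk
    -- The factor `2k` is what `conj_sub_le` produces from `G*(k (F_v(v n) - F_v(u)))`.
    obtain ⟨A, m, hA, hm, hgr⟩ := H.exists_growth R (k := 2 * k) (by positivity)
    have hbi : Integrable (fun t => 2 * (m t + A * g t)) I.measure :=
      (hm.add (hg.const_mul A)).const_mul 2
    have hmeas : ∀ n, AEStronglyMeasurable (fun t => G.conj (k • Q n t)) I.measure := fun n =>
      G.continuous_conj.comp_aestronglyMeasurable ((hQm n).const_smul k)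
    have hbd : ∀ n, ∀ᵐ t ∂I.measure, ‖G.conj (k • Q n t)‖ ≤ 2 * (m t + A * g t) := by
      intro n
      filter_upwards [hdom, hgr] with t ht h1
      rw [Real.norm_of_nonneg (G.conj_nonneg _), smul_sub]
      have e1 := (h1 _ ((v n).dot t) (ht.2.1 n).1).2.2
      have e2 := (h1 _ (u.dot t) ht.1.1).2.2
      have e3 := mul_le_mul_of_nonneg_left (ht.2.1 n).2 hA
      have e4 := mul_le_mul_of_nonneg_left ht.1.2 hA
      refine (G.conj_sub_le _ _).trans ?_
      rw [smul_smul, smul_smul]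
      linarith
    refine ⟨fun n => hbi.mono' (hmeas n) (hbd n), ?_⟩
    have key := tendsto_integral_of_dominated_convergence (μ := I.measure)
      (F := fun n t => G.conj (k • Q n t)) (f := fun _ => (0 : ℝ)) _ hmeas hbi hbd ?_
    · simpa using key
    · filter_upwards [hlim] with t ht
      have := (G.continuous_conj.tendsto _).comp (ht.2.const_smul k)
      simpa [G.conj_zero, Function.comp_def] using this
  rw [tendsto_iff_norm_sub_tendsto_zero, Metric.tendsto_nhds]
  intro ε hε
  -- With `k = 2/ε` the bound on the operator norm tends to `k⁻¹ = ε/2`.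
  obtain ⟨hQi, hQ0⟩ := hQ (2 / ε) (by positivity)
  have hsum : Tendsto (fun n => C * ∫ t, ‖P n t‖ ∂I.measure +
      (2 / ε)⁻¹ * (∫ t, G.conj ((2 / ε) • Q n t) ∂I.measure + 1)) atTop (𝓝 (ε / 2)) := by
    have := (hP0.const_mul C).add ((hQ0.add_const 1).const_mul (2 / ε)⁻¹)
    simpa using this
  filter_upwards [hsum.eventually_lt_const (half_lt_self hε)] with n hn
  rw [Real.dist_0_eq_abs, abs_norm]
  refine lt_of_le_of_lt (ContinuousLinearMap.opNorm_le_bound _ ?_ fun φ => ?_) hn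
  · have h1 : 0 ≤ ∫ t, ‖P n t‖ ∂I.measure := integral_nonneg fun _ => norm_nonneg _
    have h2 : 0 ≤ ∫ t, G.conj ((2 / ε) • Q n t) ∂I.measure :=
      integral_nonneg fun _ => G.conj_nonneg _
    positivity
  · rw [derivative_sub_apply, Real.norm_eq_abs]
    exact hpair (P n) (Q n) (2 / ε) (hPi n) (hQm n) (by positivity) (hQi n) φ

/-- The topology is metric, so it is enough that every sequence converging to `u` can be reindexed
so that the derivatives converge; the indices are chosen to make the convergence fast. -/
theorem continuous_derivative : Continuous H.derivative := by
  refine continuous_iff_continuousAt.2 fun u => tendsto_of_subseq_tendsto fun ns hns => ?_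
  have h1 : ∀ n : ℕ, ∀ᶠ k in atTop, ‖ns k - u‖ < (1 / 2 : ℝ) ^ (n + 1) := fun n =>
    (tendsto_iff_norm_sub_tendsto_zero.1 hns).eventually_lt_const (by positivity)
  choose ms hms using fun n => (h1 n).exists
  exact ⟨ms, H.tendsto_derivative_of_fast hms⟩

theorem hasLineDerivAt (u h : OrliczSobolev G I) :
    HasLineDerivAt ℝ (lagrangianFunctional G I F) (H.derivative u h) u h := by
  obtain ⟨C, hC, hCb⟩ := exists_ae_norm_le G I
  have hfun : (fun s : ℝ => lagrangianFunctional G I F (u + s • h)) = fun s : ℝ =>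
      ∫ t, F t (u.val t + s • h.val t) (u.dot t + s • h.dot t) ∂I.measure := by
    funext s
    refine integral_congr_ae ?_
    filter_upwards [ae_val_add u (s • h), ae_dot_add u (s • h), ae_val_smul s h, ae_dot_smul s h]
      with t h1 h2 h3 h4
    rw [h1, h2, h3, h4]
  have hxm : ∀ s : ℝ, AEStronglyMeasurable (fun t => u.val t + s • h.val t) I.measure :=
    fun s => u.val.aesm.add (h.val.aesm.const_smul s)
  have hvm : ∀ s : ℝ, AEStronglyMeasurable (fun t => u.dot t + s • h.dot t) I.measure :=
    fun s => u.dot.aesm.add (h.dot.aesm.const_smul s)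
  obtain ⟨A, m, hA, hm, hgr⟩ := H.exists_growth (C * ‖u‖ + C * ‖h‖) zero_le_one
  -- For `|s| < 1`, convexity and evenness give `G(u' + s h') ≤ G(2u') + G(2h')`, so `γ` dominates
  -- the growth bound uniformly in `s`.
  let γ : ℝ → ℝ := fun t => m t + A * (G ((2 : ℝ) • u.dot t) + G ((2 : ℝ) • h.dot t))
  have hγ : Integrable γ I.measure :=
    hm.add (((u.dot.integrable_comp_smul 2).add (h.dot.integrable_comp_smul 2)).const_mul A)
  have key := hasDerivAt_integral_of_dominated_loc_of_deriv_le (μ := I.measure) (𝕜 := ℝ)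
    (F := fun s t => F t (u.val t + s • h.val t) (u.dot t + s • h.dot t))
    (F' := fun s t =>
      inner ℝ (gradX F t (u.val t + s • h.val t) (u.dot t + s • h.dot t)) (h.val t) +
      inner ℝ (gradV F t (u.val t + s • h.val t) (u.dot t + s • h.dot t)) (h.dot t))
    -- The first term uses the sup bound on `h`, the other two Young's inequality `|⟨F_v, h'⟩| ≤
    -- G(h') + G*(F_v)`.
    (bound := fun t => γ t * (C * ‖h‖) + (G (h.dot t) + γ t)) (x₀ := 0)
    (Metric.ball_mem_nhds (0 : ℝ) one_pos)
    (Eventually.of_forall fun s => H.aestronglyMeasurable_comp (hxm s) (hvm s))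
    (by simpa using (H.integrable_all u).1)
    (((H.aestronglyMeasurable_gradX (hxm 0) (hvm 0)).inner h.val.aesm).add
      ((H.aestronglyMeasurable_gradV (hxm 0) (hvm 0)).inner h.dot.aesm))
    ?_ ((hγ.mul_const _).add (h.dot.integrable_comp.add hγ)) ?_
  · unfold HasLineDerivAt
    rw [hfun, derivative_apply, ← integral_add (integrable_inner_val (H.integrable_all u).2.1 h)
      (OrliczSpace.integrable_inner (H.aestronglyMeasurable_gradV u.val.aesm u.dot.aesm)
        (H.integrable_all u).2.2 h.dot)]
    simpa using key.2
  · filter_upwards [hgr, hCb u, hCb h] with t h1 h2 h3 s hs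
    rw [mem_ball_zero_iff, Real.norm_eq_abs] at hs
    have hx : ‖u.val t + s • h.val t‖ ≤ C * ‖u‖ + C * ‖h‖ := by
      refine (norm_add_le _ _).trans (add_le_add h2 (le_trans ?_ h3))
      rw [norm_smul]
      exact mul_le_of_le_one_left (norm_nonneg _) hs.le
    obtain ⟨-, h4, h5⟩ := h1 _ (u.dot t + s • h.dot t) hx
    rw [one_smul] at h5
    have h6 : G (u.dot t + s • h.dot t) ≤ G ((2 : ℝ) • u.dot t) + G ((2 : ℝ) • h.dot t) := by
      refine (G.add_le _ _).trans (add_le_add_right ?_ _)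
      rw [smul_comm]
      exact G.smul_le_self hs.le _
    have h7 : m t + A * G (u.dot t + s • h.dot t) ≤ γ t :=
      add_le_add_right (mul_le_mul_of_nonneg_left h6 hA) _
    refine (norm_add_le _ _).trans (add_le_add ?_ ?_)
    · exact (norm_inner_le_norm (𝕜 := ℝ) _ _).trans
        (mul_le_mul (h4.trans h7) h3 (norm_nonneg _) ((norm_nonneg _).trans (h4.trans h7)))
    · rw [Real.norm_eq_abs, real_inner_comm]
      exact (G.abs_inner_le _ _).trans (add_le_add_right (h5.trans h7) _)
  · filter_upwards [I.ae_mem_Ioo] with t ht s _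
    exact hasDerivAt_lagrangian_line H.contDiffOn ht _ _ _ _ s

theorem hasFDerivAt (u : OrliczSobolev G I) :
    HasFDerivAt (lagrangianFunctional G I F) (H.derivative u) u :=
  hasFDerivAt_of_hasLineDerivAt H.continuous_derivative H.hasLineDerivAt u

end IsAdmissibleLagrangian

theorem mainTheorem1 (N : ℕ) (G : GFunction N) (hG : ContDiff ℝ 1 (G : Vec N → ℝ))
    (I : FiniteInterval) (F : ℝ → Vec N → Vec N → ℝ)
    (a : ℝ≥0 → ℝ≥0) (ha : Continuous a)
    (b c : ℝ → ℝ) (hb : Integrable b I.measure) (hb0 : ∀ᵐ t ∂I.measure, 0 ≤ b t)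
    (hc : Integrable c I.measure) (hc0 : ∀ᵐ t ∂I.measure, 0 ≤ c t)
    (hF1 : ContDiffOn ℝ 1 (fun p : ℝ × Vec N × Vec N => F p.1 p.2.1 p.2.2)
      (I.carrier ×ˢ (univ : Set (Vec N × Vec N))))
    (hF2 : ∀ᵐ t ∂I.measure, ∀ x v, |F t x v| ≤ a ‖x‖₊ * (b t + G v))
    (hF3 : ∀ᵐ t ∂I.measure, ∀ x v, ‖gradX F t x v‖ ≤ a ‖x‖₊ * (b t + G v))
    (hF4 : ∀ᵐ t ∂I.measure, ∀ x v,
      G.conj (gradV F t x v) ≤ a ‖x‖₊ * (c t + G.conj (gradient (G : Vec N → ℝ) v))) :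
    (∀ u : OrliczSobolev G I,
      Integrable (fun t => F t (u.val t) (u.dot t)) I.measure) ∧
    ContDiff ℝ 1 (lagrangianFunctional G I F) ∧
    ∀ u φ : OrliczSobolev G I,
      Integrable (fun t => inner ℝ (gradX F t (u.val t) (u.dot t)) (φ.val t)) I.measure ∧
      Integrable (fun t => inner ℝ (gradV F t (u.val t) (u.dot t)) (φ.dot t)) I.measure ∧
      fderiv ℝ (lagrangianFunctional G I F) u φ =
        (∫ t, inner ℝ (gradX F t (u.val t) (u.dot t)) (φ.val t) ∂I.measure) +
          ∫ t, inner ℝ (gradV F t (u.val t) (u.dot t)) (φ.dot t) ∂I.measure := by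
  have H : IsAdmissibleLagrangian G I F a b c :=
    ⟨hG.differentiable one_ne_zero, ha, hb, hb0, hc, hc0,
      hF1.mono (prod_mono I.Ioo_subset subset_rfl), hF2, hF3, hF4⟩
  refine ⟨fun u => (H.integrable_all u).1,
    contDiff_one_iff_hasFDerivAt.2 ⟨H.derivative, H.continuous_derivative, H.hasFDerivAt⟩,
    fun u φ => ⟨OrliczSobolev.integrable_inner_val (H.integrable_all u).2.1 φ,
      OrliczSpace.integrable_inner (H.aestronglyMeasurable_gradV u.val.aesm u.dot.aesm)
        (H.integrable_all u).2.2 φ.dot, ?_⟩⟩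
  rw [(H.hasFDerivAt u).fderiv, H.derivative_apply]
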